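/- Let $S$ be a smooth surface (without boundary) with a volume form $\rho$, i.e. a smooth nowhere vanishing 2-form, which orients $S$ (for example a Riemann surface with a volume form). Let $(M,\bar g,I,J,K)$ be a hyperkähler 4-manifold: $\bar g$ is a smooth Riemannian metric, and $I,J,K$ are smooth $\bar g$-orthogonal almost complex structures, parallel for the Levi-Civita connection $\bar\nabla$ of $\bar g$, with $IJ=K$. Write $\bar\omega_1(X,Y)=\bar g(IX,Y)$, $\bar\omega_2(X,Y)=\bar g(JX,Y)$, $\bar\omega_3(X,Y)=\bar g(KX,Y)$. For a smooth immersion $f:S\to M$ let $g=f^*\bar g$ be the induced metric and $d\mu$ its area form, for the orientation given by $\rho$, and put $\lambda=d\mu/\rho$ and $N_a=f^*\bar\omega_a/\rho$ for $a=1,2,3$. Let $\xi_a$ be the Hamiltonian vector field of $N_a$ on $(S,\rho)$, defined by $\rho(\xi_a,\cdot)=dN_a$. Let $\nabla\lambda$ be the $g$-gradient of $\lambda$, viewed as a vector field along $f$ through $f_*$, and let $H=g^{ij}A(\partial_i,\partial_j)$ be the mean curvature vector, where $A(X,Y)=(\bar\nabla_X f_*Y)^N$ is the second fundamental form of $f$.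 Then for every smooth immersion $f:S\to M$, at every point of $S$, $$I f_*\xi_1+J f_*\xi_2+K f_*\xi_3=\lambda\nabla\lambda+\lambda^2H .$$ Consequently, for every set of times $T\subset\mathbb R$ (for example an interval) and every family $(f_t)_{t\in T}$ of smooth immersions $S\to M$, the family solves the H-flow $\partial_t f=I f_*\xi_1+J f_*\xi_2+K f_*\xi_3$ on $T$ if and only if it solves $\partial_t f=\lambda\nabla\lambda+\lambda^2H$ on $T$. -/

import Mathlib

open Bundle
open scoped Manifold ContDiff

noncomputable section

/-! All manifolds are real, smooth, without boundary and modelled on `EuclideanSpace ℝ (Fin n)`.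
In Mathlib the tangent space `TangentSpace (𝓡 n) p` is a copy of `EuclideanSpace ℝ (Fin n)`,
a vector being identified with its coordinates in the preferred chart `chartAt _ p` at `p`. -/

namespace HFlow

/-! ### Linear algebra -/

/-- The vector `w` with `B (w, v) = ℓ v` for all `v` (it exists and is unique when `B` is a
nondegenerate bilinear form and `ℓ` a linear form on a finite-dimensional space; see
`dualVector_spec` and `dualVector_unique`); zero if there is no such vector. -/
def dualVector {V : Type*} [Zero V] (B : V → V → ℝ) (ℓ : V → ℝ) : V :=
  open Classical in if h : ∃ w, ∀ v, B w v = ℓ v then h.choose else 0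

theorem dualVector_spec {V : Type*} [AddCommGroup V] [Module ℝ V] [FiniteDimensional ℝ V]
    (B : V →ₗ[ℝ] V →ₗ[ℝ] ℝ) (hB : ∀ w, (∀ v, B w v = 0) → w = 0) (ℓ : V →ₗ[ℝ] ℝ) (v : V) :
    B (dualVector (fun w v => B w v) ℓ) v = ℓ v := by
  have hinj : Function.Injective B := by
    rw [injective_iff_map_eq_zero]
    intro w hw
    exact hB w fun v => by rw [hw]; rfl
  have hfr : Module.finrank ℝ V = Module.finrank ℝ (V →ₗ[ℝ] ℝ) :=
    (Subspace.dual_finrank_eq (K := ℝ) (V := V)).symm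
  have hsurj : Function.Surjective B :=
    (LinearMap.injective_iff_surjective_of_finrank_eq_finrank hfr).1 hinj
  obtain ⟨w, hw⟩ := hsurj ℓ
  have h : ∃ w, ∀ v, B w v = ℓ v := ⟨w, fun v => by rw [hw]⟩
  unfold dualVector
  rw [dif_pos h]
  exact h.choose_spec v

theorem dualVector_unique {V : Type*} [AddCommGroup V] [Module ℝ V]
    (B : V →ₗ[ℝ] V →ₗ[ℝ] ℝ) (hB : ∀ w, (∀ v, B w v = 0) → w = 0) (ℓ : V → ℝ) (w : V)
    (hw : ∀ v, B w v = ℓ v) : dualVector (fun w v => B w v) ℓ = w := by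
  have h : ∃ w, ∀ v, B w v = ℓ v := ⟨w, hw⟩
  unfold dualVector
  rw [dif_pos h, ← sub_eq_zero]
  refine hB _ fun v => ?_
  rw [map_sub, LinearMap.sub_apply, hw, h.choose_spec v, sub_self]

/-! ### Tensor fields -/

section Manifold

variable {n : ℕ} {M : Type*} [TopologicalSpace M] [ChartedSpace (EuclideanSpace ℝ (Fin n)) M]

/-- The differential `dφ` at `p` of a real function `φ`. -/
def differential (φ : M → ℝ) (p : M) (v : TangentSpace (𝓡 n) p) : ℝ :=
  mfderiv (𝓡 n) 𝓘(ℝ, ℝ) φ p v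

/-- The `i`-th coordinate vector at `p`, for the preferred chart at `p`. These vectors form a basis
of the tangent space at `p`. -/
def coordVec (p : M) (i : Fin n) : TangentSpace (𝓡 n) p :=
  (EuclideanSpace.single i 1 : EuclideanSpace ℝ (Fin n))

variable [IsManifold (𝓡 n) ∞ M]

variable (n M) in
/-- Smooth Riemannian metrics on `M`. -/
abbrev Metric : Type _ :=
  ContMDiffRiemannianMetric (𝓡 n) ∞ (EuclideanSpace ℝ (Fin n))
    (fun x : M => TangentSpace (𝓡 n) x)

variable (n M) in
/-- Bilinear forms on the tangent spaces (no regularity in the base point is required). -/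
abbrev BilinField : Type _ :=
  ∀ x : M, TangentSpace (𝓡 n) x →L[ℝ] TangentSpace (𝓡 n) x →L[ℝ] ℝ

variable (n M) in
/-- Endomorphisms of the tangent spaces (no regularity in the base point is required). -/
abbrev EndField : Type _ :=
  ∀ x : M, TangentSpace (𝓡 n) x →L[ℝ] TangentSpace (𝓡 n) x

/-- Smoothness of a bilinear form field. -/
def BilinField.IsSmooth (b : BilinField n M) : Prop :=
  ContMDiff (𝓡 n)
    ((𝓡 n).prod 𝓘(ℝ, EuclideanSpace ℝ (Fin n) →L[ℝ] EuclideanSpace ℝ (Fin n) →L[ℝ] ℝ)) ∞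
    (fun x : M => TotalSpace.mk'
      (EuclideanSpace ℝ (Fin n) →L[ℝ] EuclideanSpace ℝ (Fin n) →L[ℝ] ℝ)
      (E := fun x : M => TangentSpace (𝓡 n) x →L[ℝ] TangentSpace (𝓡 n) x →L[ℝ] ℝ) x (b x))

/-- Smoothness of an endomorphism field. -/
def EndField.IsSmooth (J : EndField n M) : Prop :=
  ContMDiff (𝓡 n)
    ((𝓡 n).prod 𝓘(ℝ, EuclideanSpace ℝ (Fin n) →L[ℝ] EuclideanSpace ℝ (Fin n))) ∞
    (fun x : M => TotalSpace.mk' (EuclideanSpace ℝ (Fin n) →L[ℝ] EuclideanSpace ℝ (Fin n))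
      (E := fun x : M => TangentSpace (𝓡 n) x →L[ℝ] TangentSpace (𝓡 n) x) x (J x))

/-! ### The Levi-Civita connection -/

/-- The coordinate vector field near `p` (for the preferred chart at `p`) whose value at `p`
is `u`. Away from the domain of that chart it is zero. -/
def coordField (p : M) (u : TangentSpace (𝓡 n) p) (x : M) : TangentSpace (𝓡 n) x :=
  (trivializationAt (EuclideanSpace ℝ (Fin n)) (TangentSpace (𝓡 n)) p).symmL ℝ x u

/-- The derivative at `p`, in the direction `w`, of the function `g (U, V)`, where `U`, `V` are the
coordinate vector fields with values `u`, `v` at `p`: in coordinates, `w^C ∂_C g_{AB} u^A v^B`. -/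
def metricCoordDeriv (g : Metric n M) (p : M) (w u v : TangentSpace (𝓡 n) p) : ℝ :=
  differential (n := n) (fun x => g.inner x (coordField p u x) (coordField p v x)) p w

/-- The Christoffel symbols of `g` at `p` in the preferred chart at `p`, contracted with `u`
and `v`: the vector `Γ(u, v) = Γ^C_{AB} u^A v^B` with
`g (Γ(u, v), w) = (u^A ∂_A g_{BC} v^B w^C + v^B ∂_B g_{AC} u^A w^C - w^C ∂_C g_{AB} u^A v^B) / 2`
for all `w`. -/
def christoffel (g : Metric n M) (p : M) (u v : TangentSpace (𝓡 n) p) : TangentSpace (𝓡 n) p :=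
  dualVector (fun w w' => g.inner p w w') fun w =>
    (metricCoordDeriv g p u v w + metricCoordDeriv g p v u w - metricCoordDeriv g p w u v) / 2

end Manifold

section Maps

variable {m n : ℕ}
  {S : Type*} [TopologicalSpace S] [ChartedSpace (EuclideanSpace ℝ (Fin m)) S]
  [IsManifold (𝓡 m) ∞ S]
  {M : Type*} [TopologicalSpace M] [ChartedSpace (EuclideanSpace ℝ (Fin n)) M]
  [IsManifold (𝓡 n) ∞ M]

/-- The differential `f_*` of a map, at `p`. -/
abbrev push (f : S → M) (p : S) : TangentSpace (𝓡 m) p →L[ℝ] TangentSpace (𝓡 n) (f p) :=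
  mfderiv (𝓡 m) (𝓡 n) f p

/-- The Levi-Civita covariant derivative `∇̄_u V` at `p`, in the direction `u`, of a vector field
`V` along the map `f : S → M`: in the preferred coordinates `y` at `f p` it is
`u(V^C) + Γ^C_{AB} u(f^A) V^B`. For `f = id` this is the Levi-Civita connection of `(M, g)`. -/
def covDerivAlong (g : Metric n M) (f : S → M) (V : ∀ x : S, TangentSpace (𝓡 n) (f x))
    (p : S) (u : TangentSpace (𝓡 m) p) : TangentSpace (𝓡 n) (f p) :=
  let dV : TangentSpace (𝓡 n) (f p) :=
    mfderiv (𝓡 m) 𝓘(ℝ, EuclideanSpace ℝ (Fin n))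
      (fun x => (trivializationAt (EuclideanSpace ℝ (Fin n)) (TangentSpace (𝓡 n))
        (f p)).continuousLinearMapAt ℝ (f x) (V x)) p u
  dV + christoffel g (f p) (push f p u) (V p)

/-- `f` is a smooth immersion. -/
structure IsSmoothImmersion (m n : ℕ)
    {S : Type*} [TopologicalSpace S] [ChartedSpace (EuclideanSpace ℝ (Fin m)) S]
    {M : Type*} [TopologicalSpace M] [ChartedSpace (EuclideanSpace ℝ (Fin n)) M]
    (f : S → M) : Prop where
  smooth : ContMDiff (𝓡 m) (𝓡 n) ∞ f
  injective : ∀ p, Function.Injective (push (m := m) (n := n) f p)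

/-- The pullback `(f^* b) (u, v) = b (f_* u, f_* v)`. -/
def pullback (f : S → M) (b : BilinField n M) (p : S) (u v : TangentSpace (𝓡 m) p) : ℝ :=
  b (f p) (push f p u) (push f p v)

/-- The induced metric `f^* ḡ`. -/
def inducedMetric (g : Metric n M) (f : S → M) : ∀ p : S,
    TangentSpace (𝓡 m) p → TangentSpace (𝓡 m) p → ℝ :=
  pullback f g.inner

/-- The normal part `w^N` of a vector `w` in `T_{f p} M`: one subtracts from `w` the tangential part
`f_* z`, where `z` satisfies `ḡ (f_* z, f_* v) = ḡ (w, f_* v)` for all `v`. -/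
def normalPart (g : Metric n M) (f : S → M) (p : S) (w : TangentSpace (𝓡 n) (f p)) :
    TangentSpace (𝓡 n) (f p) :=
  w - push f p (dualVector (fun z v : TangentSpace (𝓡 m) p => inducedMetric g f p z v)
    fun v : TangentSpace (𝓡 m) p => g.inner (f p) w (push f p v))

/-- The second fundamental form `A (u, v) = (∇̄_u f_* V)^N` of `f` at `p`, where `V` is the
coordinate vector field near `p` with value `v` at `p`. -/
def secondFundamentalForm (g : Metric n M) (f : S → M) (p : S) (u v : TangentSpace (𝓡 m) p) :
    TangentSpace (𝓡 n) (f p) :=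
  normalPart (m := m) g f p (covDerivAlong g f (fun x => push f x (coordField p v x)) p u)

/-- The mean curvature vector `H = g^{ij} A (∂_i, ∂_j)` of `f` at `p`, where `g = f^* ḡ`. -/
def meanCurvature (g : Metric n M) (f : S → M) (p : S) : TangentSpace (𝓡 n) (f p) :=
  ∑ i, ∑ j,
    (Matrix.of fun k l : Fin m => inducedMetric g f p (coordVec p k) (coordVec p l))⁻¹ i j •
      secondFundamentalForm g f p (coordVec p i) (coordVec p j)

/-- The gradient `∇φ` of a function `φ` on `S` for the induced metric. -/
def gradient (g : Metric n M) (f : S → M) (φ : S → ℝ) (p : S) : TangentSpace (𝓡 m) p :=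
  dualVector (fun z v => inducedMetric g f p z v) (differential φ p)

end Maps

/-! ### Hyperkähler manifolds -/

section Hyperkahler

variable {n : ℕ} {M : Type*} [TopologicalSpace M] [ChartedSpace (EuclideanSpace ℝ (Fin n)) M]
  [IsManifold (𝓡 n) ∞ M]

/-- The endomorphism field `J` is parallel: `∇_u (J Y) = J (∇_u Y)` for every vector field `Y` that
is differentiable at the point considered. -/
def IsParallel (g : Metric n M) (J : EndField n M) : Prop :=
  ∀ (p : M) (u : TangentSpace (𝓡 n) p) (Y : ∀ x : M, TangentSpace (𝓡 n) x),
    MDifferentiableAt (𝓡 n) ((𝓡 n).prod 𝓘(ℝ, EuclideanSpace ℝ (Fin n)))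
      (fun x => TotalSpace.mk' (EuclideanSpace ℝ (Fin n)) x (Y x)) p →
    covDerivAlong g (id : M → M) (fun x => J x (Y x)) p u
      = J p (covDerivAlong g (id : M → M) Y p u)

/-- `J` is a Kähler structure on the Riemannian manifold `(M, g)`: a smooth orthogonal almost
complex structure, parallel for the Levi-Civita connection. -/
structure IsKahler (g : Metric n M) (J : EndField n M) : Prop where
  smooth : EndField.IsSmooth J
  sq : ∀ x v, J x (J x v) = -v
  orthogonal : ∀ x v w, g.inner x (J x v) (J x w) = g.inner x v w
  parallel : IsParallel g J

/-- The Kähler form `ω (X, Y) = g (J X, Y)`. -/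
def kahlerForm (g : Metric n M) (J : EndField n M) : BilinField n M :=
  fun x => (g.inner x).comp (J x)

end Hyperkahler

/-- A hyperkähler structure `(g, I, J, K)` on the 4-manifold `M`. -/
structure HyperkahlerStructure (M : Type*) [TopologicalSpace M]
    [ChartedSpace (EuclideanSpace ℝ (Fin 4)) M] [IsManifold (𝓡 4) ∞ M] where
  metric : Metric 4 M
  I : EndField 4 M
  J : EndField 4 M
  K : EndField 4 M
  kahler_I : IsKahler metric I
  kahler_J : IsKahler metric J
  kahler_K : IsKahler metric K
  mul_eq : ∀ x v, I x (J x v) = K x v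

/-- A volume form on the surface `S`: a smooth nowhere vanishing 2-form. It orients `S`. -/
structure VolumeForm (S : Type*) [TopologicalSpace S]
    [ChartedSpace (EuclideanSpace ℝ (Fin 2)) S] [IsManifold (𝓡 2) ∞ S] where
  form : BilinField 2 S
  smooth : BilinField.IsSmooth form
  alternating : ∀ x v, form x v v = 0
  ne_zero : ∀ x, form x ≠ 0

section Flow

variable
  {S : Type*} [TopologicalSpace S] [ChartedSpace (EuclideanSpace ℝ (Fin 2)) S]
  [IsManifold (𝓡 2) ∞ S]
  {M : Type*} [TopologicalSpace M] [ChartedSpace (EuclideanSpace ℝ (Fin 4)) M]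
  [IsManifold (𝓡 4) ∞ M]

/-- The function `N = f^* ω / ρ` (quotient of 2-forms on a surface), where `ω` is the Kähler form
of `J`. -/
def kahlerRatio (ρ : VolumeForm S) (g : Metric 4 M) (J : EndField 4 M) (f : S → M) (p : S) : ℝ :=
  pullback f (kahlerForm g J) p (coordVec (n := 2) p 0) (coordVec (n := 2) p 1)
    / ρ.form p (coordVec (n := 2) p 0) (coordVec (n := 2) p 1)

/-- The induced area form `dμ` of an immersion, for the orientation given by `ρ`:
`dμ (u, v)` is the `f^* ḡ`-area of the parallelogram spanned by `u` and `v`, with the sign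
of `ρ (u, v)`. -/
def areaForm (ρ : VolumeForm S) (g : Metric 4 M) (f : S → M) (p : S)
    (u v : TangentSpace (𝓡 2) p) : ℝ :=
  (SignType.sign (ρ.form p u v) : ℝ) *
    Real.sqrt (inducedMetric g f p u u * inducedMetric g f p v v - inducedMetric g f p u v ^ 2)

/-- The function `λ = dμ / ρ`. -/
def areaRatio (ρ : VolumeForm S) (g : Metric 4 M) (f : S → M) (p : S) : ℝ :=
  areaForm ρ g f p (coordVec (n := 2) p 0) (coordVec (n := 2) p 1) / ρ.form p (coordVec (n := 2) p 0) (coordVec (n := 2) p 1)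

/-- The Hamiltonian vector field `ξ` of the function `N` on `(S, ρ)`: `ρ (ξ, ·) = dN`. -/
def hamiltonianField (ρ : VolumeForm S) (N : S → ℝ) (p : S) : TangentSpace (𝓡 2) p :=
  dualVector (fun z v => ρ.form p z v) (differential N p)

/-- The right-hand side `I f_* ξ₁ + J f_* ξ₂ + K f_* ξ₃` of the H-flow. -/
def hFlowVelocity (ρ : VolumeForm S) (h : HyperkahlerStructure M) (f : S → M) (p : S) :
    TangentSpace (𝓡 4) (f p) :=
  h.I (f p) (push f p (hamiltonianField ρ (kahlerRatio ρ h.metric h.I f) p))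
    + h.J (f p) (push f p (hamiltonianField ρ (kahlerRatio ρ h.metric h.J f) p))
    + h.K (f p) (push f p (hamiltonianField ρ (kahlerRatio ρ h.metric h.K f) p))

/-- The vector field `λ ∇λ + λ² H` along `f`, where `∇λ` is viewed in `TM` through `f_*`. -/
def meanCurvatureVelocity (ρ : VolumeForm S) (g : Metric 4 M) (f : S → M) (p : S) :
    TangentSpace (𝓡 4) (f p) :=
  areaRatio ρ g f p • push f p (gradient (m := 2) g f (areaRatio ρ g f) p)
    + areaRatio ρ g f p ^ 2 • meanCurvature (m := 2) g f p

/-- The family `F t` satisfies, at all times `t` in the set `T`, the evolution equation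
`∂F/∂t = X (F t)`. At end points of a time interval the derivative is one-sided. -/
def SolvesFlow (X : ∀ (f : S → M) (p : S), TangentSpace (𝓡 4) (f p)) (T : Set ℝ)
    (F : ℝ → S → M) : Prop :=
  ∀ t ∈ T, ∀ p : S, HasMFDerivWithinAt 𝓘(ℝ, ℝ) (𝓡 4) (fun s => F s p) T t
    ((1 : ℝ →L[ℝ] ℝ).smulRight (X (F t) p))

end Flow

end HFlow

end

/-! Fix a point p. Let v₁, v₂ be the images under f_* of the coordinate vectors at p, Dᵢⱼ = ∇̄ᵢ
f_*∂ⱼ, r the coefficient of ρ and Δ the Gram determinant of v₁, v₂, so that λ² = Δ / r². A parallel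
form b satisfies the product rule ∂ᵤ(b(v₁, v₂)) = b(Dᵤ₁, v₂) + b(v₁, Dᵤ₂). This rule applies to the
metric and, because I, J, K are parallel, to the three Kähler forms (`IsKahler.isParallelForm`,
`IsParallelForm.fderiv_coordPullback`). It expresses dN_a and dλ through the Dᵢⱼ, r and dr.

On the surface, ξ_a = (∂₂N_a / r) ∂₁ - (∂₁N_a / r) ∂₂. Skewness of I, J, K then turns I f_*ξ₁ + J
f_*ξ₂ + K f_*ξ₃ into a combination of sums Σ_L G(v, L x) L y over L = I, J, K. Since x, Ix, Jx, Kx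
is an orthogonal basis of vectors of equal length, Σ_L G(v, L x) L x = G(x, x) v - G(v, x) x
(`quaternionic_expansion`). The mixed derivative D₁₂ = D₂₁ occurs only in a combination symmetric in
v₁ and v₂, to which the polarized identity applies. All complex structures thereby disappear. What
remains has second-order part (G₂₂ D₁₁ - 2 G₁₂ D₁₂ + G₁₁ D₂₂) / r², whose normal component is λ² H;
the tangential remainder is λ∇λ = ½∇(λ²). This pointwise algebra is `hamiltonian_sum_eq`.

The analytic work is to reach these formulas. N_a and λ are defined at each x by the preferred chart
at x, which changes with x. Being quotients of forms of top degree they do not depend on the frame,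
so near p they can be computed in the single chart at p (`kahlerRatio_eventuallyEq`,
`areaRatio_eventuallyEq`). The statement about flows follows by applying the pointwise identity to
each immersion of the family. -/

namespace HFlow

noncomputable section

open scoped Topology

set_option maxSynthPendingDepth 3

/-! ### Quaternionic linear algebra on a four-dimensional Euclidean space. -/

section Quaternionic

variable {V : Type*} [NormedAddCommGroup V] [NormedSpace ℝ V]
  {G : V →L[ℝ] V →L[ℝ] ℝ} {I J K : V →L[ℝ] V}

/-- A complex structure orthogonal for a bilinear form is skew for it. -/
theorem skew_of_orthogonal (hJ : ∀ v, J (J v) = -v) (hJG : ∀ v w, G (J v) (J w) = G v w) (v w : V) :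
    G (J v) w = -G v (J w) := by
  rw [← hJG v (J w), hJ, map_neg, neg_neg]

theorem apply_self_eq_zero_of_orthogonal (hG : ∀ v w, G v w = G w v) (hJ : ∀ v, J (J v) = -v)
    (hJG : ∀ v w, G (J v) (J w) = G v w) (v : V) : G (J v) v = 0 := by
  have h1 := skew_of_orthogonal hJ hJG v v
  have h2 := hG v (J v)
  linarith

/-- For `x ≠ 0`, the vectors `x`, `I x`, `J x`, `K x` form an orthogonal basis consisting of vectors
of the same length; this expands a vector `v` in that basis. -/
theorem quaternionic_expansion (hV : Module.finrank ℝ V = 4)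
    (hG : ∀ v w, G v w = G w v) (hpos : ∀ v, v ≠ 0 → 0 < G v v)
    (hI : ∀ v, I (I v) = -v) (hIG : ∀ v w, G (I v) (I w) = G v w)
    (hJ : ∀ v, J (J v) = -v) (hJG : ∀ v w, G (J v) (J w) = G v w)
    (hK : ∀ v, K (K v) = -v) (hKG : ∀ v w, G (K v) (K w) = G v w)
    (hIJ : ∀ v, I (J v) = K v) (v x : V) :
    G v (I x) • I x + G v (J x) • J x + G v (K x) • K x = G x x • v - G v x • x := by
  by_cases hx : x = 0
  · simp [hx]
  have := FiniteDimensional.of_finrank_pos (K := ℝ) (V := V) (by omega)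
  have hxx := hpos x hx
  have i0 : G (I x) x = 0 := apply_self_eq_zero_of_orthogonal hG hI hIG x
  have j0 : G (J x) x = 0 := apply_self_eq_zero_of_orthogonal hG hJ hJG x
  have k0 : G (K x) x = 0 := apply_self_eq_zero_of_orthogonal hG hK hKG x
  have i0' : G x (I x) = 0 := by rw [hG, i0]
  have j0' : G x (J x) = 0 := by rw [hG, j0]
  have k0' : G x (K x) = 0 := by rw [hG, k0]
  have ij : G (I x) (J x) = 0 := by rw [← hIG, hI, hIJ]; simp [k0']
  have ik : G (I x) (K x) = 0 := by rw [← hIJ, hIG, j0']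
  have jk : G (J x) (K x) = 0 := by
    rw [← hIJ, hG, apply_self_eq_zero_of_orthogonal hG hI hIG]
  have ij' : G (J x) (I x) = 0 := by rw [hG, ij]
  have ik' : G (K x) (I x) = 0 := by rw [hG, ik]
  have jk' : G (K x) (J x) = 0 := by rw [hG, jk]
  -- Pairing a vanishing combination with each of the four orthogonal vectors isolates its
  -- coefficients.
  have hli : LinearIndependent ℝ ![x, I x, J x, K x] := by
    rw [Fintype.linearIndependent_iff]
    intro c hc
    simp only [Fin.sum_univ_four, Matrix.cons_val] at hc
    have e0 := congrArg (fun y => G y x) hc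
    have e1 := congrArg (fun y => G y (I x)) hc
    have e2 := congrArg (fun y => G y (J x)) hc
    have e3 := congrArg (fun y => G y (K x)) hc
    simp [i0, j0, k0, i0', j0', k0', ij, ik, jk, ij', ik', jk', hIG, hJG, hKG, hxx.ne']
      at e0 e1 e2 e3
    intro i
    fin_cases i <;> assumption
  let b := basisOfLinearIndependentOfCardEqFinrank hli (by simp [hV])
  rw [← sub_eq_zero]
  -- The difference W of the two sides is orthogonal to the whole basis, so G W = 0, and positivity
  -- forces W = 0.
  set W := G v (I x) • I x + G v (J x) • J x + G v (K x) • K x - (G x x • v - G v x • x) with hW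
  have hWb : G W = 0 := by
    apply ContinuousLinearMap.coe_injective
    refine b.ext fun i => ?_
    fin_cases i <;>
      simp [b, hW, i0, j0, k0, i0', j0', k0', ij, ik, jk, ij', ik', jk', hIG, hJG, hKG] <;> ring
  by_contra hne
  have := hpos W hne
  simp [hWb] at this

/-- Both sides of the expansion are quadratic in x, so comparing x + y with x and y gives the
bilinear version. It handles the mixed derivative D₁₂, which is paired with both tangent vectors. -/
theorem quaternionic_expansion_polarized (hV : Module.finrank ℝ V = 4)
    (hG : ∀ v w, G v w = G w v) (hpos : ∀ v, v ≠ 0 → 0 < G v v)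
    (hI : ∀ v, I (I v) = -v) (hIG : ∀ v w, G (I v) (I w) = G v w)
    (hJ : ∀ v, J (J v) = -v) (hJG : ∀ v w, G (J v) (J w) = G v w)
    (hK : ∀ v, K (K v) = -v) (hKG : ∀ v w, G (K v) (K w) = G v w)
    (hIJ : ∀ v, I (J v) = K v) (v x y : V) :
    (G v (I x) • I y + G v (I y) • I x) + (G v (J x) • J y + G v (J y) • J x)
      + (G v (K x) • K y + G v (K y) • K x)
      = (2 * G x y) • v - G v x • y - G v y • x := by
  have h := quaternionic_expansion hV hG hpos hI hIG hJ hJG hK hKG hIJ v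
  have hxy := h (x + y)
  have hx := h x
  have hy := h y
  simp only [map_add, add_apply, hG y x] at hxy
  linear_combination (norm := module) hxy - hx - hy

/-- The pointwise identity behind the equality of the two flows. Here `v₁, v₂` are the coordinate
tangent vectors, `Dᵢⱼ` the covariant derivatives of `vⱼ` in the direction `i`, `r` the coefficient
of the volume form and `r₁, r₂` its partial derivatives. -/
theorem hamiltonian_sum_eq (hV : Module.finrank ℝ V = 4)
    (hG : ∀ v w, G v w = G w v) (hpos : ∀ v, v ≠ 0 → 0 < G v v)
    (hI : ∀ v, I (I v) = -v) (hIG : ∀ v w, G (I v) (I w) = G v w)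
    (hJ : ∀ v, J (J v) = -v) (hJG : ∀ v w, G (J v) (J w) = G v w)
    (hK : ∀ v, K (K v) = -v) (hKG : ∀ v w, G (K v) (K w) = G v w)
    (hIJ : ∀ v, I (J v) = K v) (v₁ v₂ D₁₁ D₁₂ D₂₂ : V) (r r₁ r₂ Δ : ℝ) (hr : r ≠ 0)
    (hΔ : Δ = G v₁ v₁ * G v₂ v₂ - G v₁ v₂ ^ 2) (hΔ0 : Δ ≠ 0)
    (N₁ N₂ : (V →L[ℝ] V) → ℝ)
    (hN₁ : ∀ L, N₁ L = (G (L D₁₁) v₂ + G (L v₁) D₁₂) / r - G (L v₁) v₂ * r₁ / r ^ 2)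
    (hN₂ : ∀ L, N₂ L = (G (L D₁₂) v₂ + G (L v₁) D₂₂) / r - G (L v₁) v₂ * r₂ / r ^ 2)
    (Δ₁ Δ₂ m₁ m₂ : ℝ)
    (hΔ₁ : Δ₁ = 2 * G D₁₁ v₁ * G v₂ v₂ + 2 * G v₁ v₁ * G D₁₂ v₂
      - 2 * G v₁ v₂ * (G D₁₁ v₂ + G v₁ D₁₂))
    (hΔ₂ : Δ₂ = 2 * G D₁₂ v₁ * G v₂ v₂ + 2 * G v₁ v₁ * G D₂₂ v₂
      - 2 * G v₁ v₂ * (G D₁₂ v₂ + G v₁ D₂₂))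
    (hm₁ : m₁ = Δ₁ / (2 * r ^ 2) - Δ * r₁ / r ^ 3)
    (hm₂ : m₂ = Δ₂ / (2 * r ^ 2) - Δ * r₂ / r ^ 3)
    (nor : V → V)
    (hnor : ∀ D, nor D = D - (((G v₂ v₂ * G D v₁ - G v₁ v₂ * G D v₂) / Δ) • v₁
      + ((G v₁ v₁ * G D v₂ - G v₁ v₂ * G D v₁) / Δ) • v₂)) :
    I ((N₂ I / r) • v₁ - (N₁ I / r) • v₂) + J ((N₂ J / r) • v₁ - (N₁ J / r) • v₂)
        + K ((N₂ K / r) • v₁ - (N₁ K / r) • v₂)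
      = (((G v₂ v₂ * m₁ - G v₁ v₂ * m₂) / Δ) • v₁ + ((G v₁ v₁ * m₂ - G v₁ v₂ * m₁) / Δ) • v₂)
        + (Δ / r ^ 2) • ((G v₂ v₂ / Δ) • nor D₁₁ + (-G v₁ v₂ / Δ) • nor D₁₂
          + ((-G v₁ v₂ / Δ) • nor D₁₂ + (G v₁ v₁ / Δ) • nor D₂₂)) := by
  have q := quaternionic_expansion hV hG hpos hI hIG hJ hJG hK hKG hIJ
  have h₁ := q v₂ v₁
  have h₂ := q v₁ v₂
  have h₃ := q D₂₂ v₁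
  have h₄ := q D₁₁ v₂
  have h₅ := quaternionic_expansion_polarized hV hG hpos hI hIG hJ hJG hK hKG hIJ D₁₂ v₁ v₂
  have key : I ((N₂ I / r) • v₁ - (N₁ I / r) • v₂) + J ((N₂ J / r) • v₁ - (N₁ J / r) • v₂)
        + K ((N₂ K / r) • v₁ - (N₁ K / r) • v₂)
      = (1 / r ^ 2) • (G v₁ v₁ • D₂₂ - G D₂₂ v₁ • v₁ + (G v₂ v₂ • D₁₁ - G D₁₁ v₂ • v₂)
          - ((2 * G v₁ v₂) • D₁₂ - G D₁₂ v₁ • v₂ - G D₁₂ v₂ • v₁))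
        - (r₂ / r ^ 3) • (G v₁ v₁ • v₂ - G v₁ v₂ • v₁)
        - (r₁ / r ^ 3) • (G v₂ v₂ • v₁ - G v₁ v₂ • v₂) := by
    -- Each bracket on the right is read backwards as a sum over I, J, K. The symmetry of G is used
    -- to match the two brackets coming from the derivatives of r, which need G v₂ v₁ and G v₁ v₂
    -- respectively.
    rw [← h₃, ← h₄, ← h₅, ← hG v₂ v₁, ← h₁, hG v₂ v₁, ← h₂]
    simp only [hN₁, hN₂, map_sub, map_smul, skew_of_orthogonal hI hIG,
      skew_of_orthogonal hJ hJG, skew_of_orthogonal hK hKG]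
    rw [hG v₂ (I v₁), hG v₂ (J v₁), hG v₂ (K v₁), hG D₂₂ (I v₁), hG D₂₂ (J v₁), hG D₂₂ (K v₁),
      hG D₁₂ (I v₁), hG D₁₂ (J v₁), hG D₁₂ (K v₁)]
    simp only [skew_of_orthogonal hI hIG,
      skew_of_orthogonal hJ hJG, skew_of_orthogonal hK hKG]
    module
  rw [key]
  -- Here mᵢ plays the role of λ ∂ᵢλ. No complex structure is left, and it suffices to compare the
  -- coefficients of v₁, v₂, D₁₁, D₁₂, D₂₂.
  simp only [hnor, hm₁, hm₂, hΔ₁, hΔ₂, hG v₁ D₁₂, hG v₁ D₂₂]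
  match_scalars <;> field_simp <;> (try rw [hΔ]) <;> ring

end Quaternionic

/-- A basis of the finite-dimensional space E identifies E →L[ℝ] F with a finite power of F, where
differentiability is checked componentwise. It reduces differentiability of tensor coefficients to
evaluation on constant vectors. -/
theorem differentiableAt_clm_of_apply {D E F : Type*} [NormedAddCommGroup D] [NormedSpace ℝ D]
    [NormedAddCommGroup E] [NormedSpace ℝ E] [FiniteDimensional ℝ E]
    [NormedAddCommGroup F] [NormedSpace ℝ F] {f : D → E →L[ℝ] F} {x : D}
    (h : ∀ v, DifferentiableAt ℝ (fun y => f y v) x) : DifferentiableAt ℝ f x := by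
  let d := Module.finrank ℝ E
  have hd : d = Module.finrank ℝ (Fin d → ℝ) := (Module.finrank_fin_fun ℝ).symm
  let e₁ := ContinuousLinearEquiv.ofFinrankEq hd
  let e₂ := (e₁.arrowCongr (1 : F ≃L[ℝ] F)).trans (ContinuousLinearEquiv.piRing (Fin d))
  rw [← Function.id_comp f, ← e₂.symm_comp_self]
  exact e₂.symm.differentiableAt.comp x (differentiableAt_pi.mpr fun i => h _)

/-! ### Functions and tensor fields in the preferred chart at a point. -/

section Chart

variable {n : ℕ} {M : Type*} [TopologicalSpace M] [ChartedSpace (EuclideanSpace ℝ (Fin n)) M]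
  {F : Type*} [NormedAddCommGroup F] [NormedSpace ℝ F]

theorem eventually_mem_chart_source (p : M) :
    ∀ᶠ x in 𝓝 p, x ∈ (chartAt (EuclideanSpace ℝ (Fin n)) p).source :=
  (chartAt _ p).open_source.mem_nhds (mem_chart_source _ p)

theorem tendsto_chart_symm (p : M) :
    Filter.Tendsto (chartAt (EuclideanSpace ℝ (Fin n)) p).symm
      (𝓝 (chartAt (EuclideanSpace ℝ (Fin n)) p p)) (𝓝 p) := by
  have h := (chartAt (EuclideanSpace ℝ (Fin n)) p).continuousAt_symm
    ((chartAt (EuclideanSpace ℝ (Fin n)) p).map_source (mem_chart_source _ p))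
  rwa [ContinuousAt, OpenPartialHomeomorph.left_inv _ (mem_chart_source _ p)] at h

/-- Tangent vectors at p are coordinates in the chart at p, so no transition factor appears.
Agreement only near p is required, which leaves φ' free to be a convenient coordinate formula. -/
theorem hasMFDerivAt_chart {φ : M → F} {φ' : EuclideanSpace ℝ (Fin n) → F} {p : M}
    (h : φ ∘ (chartAt (EuclideanSpace ℝ (Fin n)) p).symm
      =ᶠ[𝓝 (chartAt (EuclideanSpace ℝ (Fin n)) p p)] φ')
    (hd : DifferentiableAt ℝ φ' (chartAt (EuclideanSpace ℝ (Fin n)) p p)) :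
    HasMFDerivAt (𝓡 n) 𝓘(ℝ, F) φ p (fderiv ℝ φ' (chartAt (EuclideanSpace ℝ (Fin n)) p p)) := by
  have hd' := hd.hasFDerivAt.congr_of_eventuallyEq h
  refine ⟨?_, ?_⟩
  -- Continuity of φ at p is recovered from that of its chart expression.
  · have h1 : ContinuousAt (chartAt (EuclideanSpace ℝ (Fin n)) p) p :=
      (chartAt (EuclideanSpace ℝ (Fin n)) p).continuousAt (mem_chart_source _ p)
    have h2 := hd'.continuousAt.comp h1
    refine h2.congr ?_
    filter_upwards [eventually_mem_chart_source (n := n) p] with x hx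
    simp [hx]
  · simp only [writtenInExtChartAt, mfld_simps]
    exact hd'.hasFDerivWithinAt

theorem mfderiv_apply_eq_fderiv_chart {φ : M → F} {φ' : EuclideanSpace ℝ (Fin n) → F} {p : M}
    (h : φ ∘ (chartAt (EuclideanSpace ℝ (Fin n)) p).symm
      =ᶠ[𝓝 (chartAt (EuclideanSpace ℝ (Fin n)) p p)] φ')
    (hd : DifferentiableAt ℝ φ' (chartAt (EuclideanSpace ℝ (Fin n)) p p))
    (u : EuclideanSpace ℝ (Fin n)) :
    mfderiv (𝓡 n) 𝓘(ℝ, F) φ p u = fderiv ℝ φ' (chartAt (EuclideanSpace ℝ (Fin n)) p p) u :=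
  congrArg (fun L : EuclideanSpace ℝ (Fin n) →L[ℝ] F => L u)
    (hasMFDerivAt_chart h hd).mfderiv

theorem differentiableAt_chart_symm {φ : M → F} {p : M}
    (h : MDifferentiableAt (𝓡 n) 𝓘(ℝ, F) φ p) :
    DifferentiableAt ℝ (φ ∘ (chartAt (EuclideanSpace ℝ (Fin n)) p).symm)
      (chartAt (EuclideanSpace ℝ (Fin n)) p p) := by
  have := h.differentiableWithinAt_writtenInExtChartAt
  simp only [writtenInExtChartAt, mfld_simps] at this
  exact differentiableWithinAt_univ.mp this

variable [IsManifold (𝓡 n) ∞ M]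

variable (n M) in
/-- The coordinates of tangent vectors at `x` in the chart at `p`. -/
abbrev toCoord (p x : M) : TangentSpace (𝓡 n) x →L[ℝ] EuclideanSpace ℝ (Fin n) :=
  (trivializationAt (EuclideanSpace ℝ (Fin n)) (TangentSpace (𝓡 n)) p).continuousLinearMapAt ℝ x

variable (n M) in
/-- The tangent vectors at `x` with given coordinates in the chart at `p`. -/
abbrev ofCoord (p x : M) : EuclideanSpace ℝ (Fin n) →L[ℝ] TangentSpace (𝓡 n) x :=
  (trivializationAt (EuclideanSpace ℝ (Fin n)) (TangentSpace (𝓡 n)) p).symmL ℝ x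

theorem ofCoord_toCoord {p x : M} (hx : x ∈ (chartAt (EuclideanSpace ℝ (Fin n)) p).source)
    (v : TangentSpace (𝓡 n) x) : ofCoord n M p x (toCoord n M p x v) = v :=
  Trivialization.symmL_continuousLinearMapAt _ (by simpa using hx) v

theorem toCoord_ofCoord {p x : M} (hx : x ∈ (chartAt (EuclideanSpace ℝ (Fin n)) p).source)
    (v : EuclideanSpace ℝ (Fin n)) : toCoord n M p x (ofCoord n M p x v) = v :=
  Trivialization.continuousLinearMapAt_symmL _ (by simpa using hx) v

theorem toCoord_self (p : M) (v : TangentSpace (𝓡 n) p) : toCoord n M p p v = v := by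
  have : IsManifold (𝓡 n) 1 M := IsManifold.of_le (n := ∞) (by simp)
  rw [toCoord, TangentBundle.continuousLinearMapAt_trivializationAt (mem_chart_source _ p),
    mfderiv_extChartAt_self]
  rfl

theorem ofCoord_self (p : M) (v : EuclideanSpace ℝ (Fin n)) : ofCoord n M p p v = v := by
  exact (toCoord_self p (ofCoord n M p p v)).symm.trans (toCoord_ofCoord (mem_chart_source _ p) v)

/-- In the trivialization at p the field has the constant value v near p. -/
theorem contMDiffAt_coordField (p : M) (v : EuclideanSpace ℝ (Fin n)) :
    ContMDiffAt (𝓡 n) ((𝓡 n).prod 𝓘(ℝ, EuclideanSpace ℝ (Fin n))) ∞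
      (fun x => TotalSpace.mk' (EuclideanSpace ℝ (Fin n)) x (ofCoord n M p x v)) p := by
  rw [contMDiffAt_section]
  refine (contMDiffAt_const (c := v)).congr_of_eventuallyEq ?_
  filter_upwards [eventually_mem_chart_source (n := n) p] with x hx
  have h := toCoord_ofCoord (n := n) hx v
  rwa [toCoord, Trivialization.continuousLinearMapAt_apply,
    Trivialization.coe_linearMapAt_of_mem _ (by simpa using hx)] at h

/-- The bilinear form field `b` in the chart at `p`. -/
def coordForm (b : BilinField n M) (p : M) (y : EuclideanSpace ℝ (Fin n)) :
    EuclideanSpace ℝ (Fin n) →L[ℝ] EuclideanSpace ℝ (Fin n) →L[ℝ] ℝ :=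
  let x := (chartAt (EuclideanSpace ℝ (Fin n)) p).symm y
  let b' : EuclideanSpace ℝ (Fin n) →L[ℝ] EuclideanSpace ℝ (Fin n) →L[ℝ] ℝ := b x
  let T : EuclideanSpace ℝ (Fin n) →L[ℝ] EuclideanSpace ℝ (Fin n) := ofCoord n M p x
  b'.bilinearComp T T

/-- The endomorphism field `J` in the chart at `p`. -/
def coordEnd (J : EndField n M) (p : M) (y : EuclideanSpace ℝ (Fin n)) :
    EuclideanSpace ℝ (Fin n) →L[ℝ] EuclideanSpace ℝ (Fin n) :=
  let x := (chartAt (EuclideanSpace ℝ (Fin n)) p).symm y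
  toCoord n M p x ∘L J x ∘L ofCoord n M p x

theorem coordForm_apply (b : BilinField n M) (p : M) (y u v : EuclideanSpace ℝ (Fin n)) :
    coordForm b p y u v = b ((chartAt (EuclideanSpace ℝ (Fin n)) p).symm y)
      (ofCoord n M p _ u) (ofCoord n M p _ v) := rfl

theorem coordForm_chart (b : BilinField n M) (p : M) (u v : EuclideanSpace ℝ (Fin n)) :
    coordForm b p (chartAt (EuclideanSpace ℝ (Fin n)) p p) u v = b p u v := by
  rw [coordForm_apply, OpenPartialHomeomorph.left_inv _ (mem_chart_source _ p), ofCoord_self,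
    ofCoord_self]

theorem coordEnd_chart (J : EndField n M) (p : M) (u : EuclideanSpace ℝ (Fin n)) :
    coordEnd J p (chartAt (EuclideanSpace ℝ (Fin n)) p p) u = J p u := by
  simp only [coordEnd, ContinuousLinearMap.comp_apply]
  rw [OpenPartialHomeomorph.left_inv _ (mem_chart_source _ p), ofCoord_self, toCoord_self]

/-- The coefficients are the values of the smooth form on smooth coordinate fields. -/
theorem BilinField.IsSmooth.differentiableAt_coordForm {b : BilinField n M} (hb : b.IsSmooth)
    (p : M) : DifferentiableAt ℝ (coordForm b p) (chartAt (EuclideanSpace ℝ (Fin n)) p p) := by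
  refine differentiableAt_clm_of_apply fun u => differentiableAt_clm_of_apply fun v => ?_
  have h : ContMDiffAt (𝓡 n) ((𝓡 n).prod 𝓘(ℝ, ℝ)) ∞ (fun x => TotalSpace.mk' ℝ
      (E := Bundle.Trivial M ℝ) x (b x (ofCoord n M p x u) (ofCoord n M p x v))) p :=
    ContMDiffAt.clm_bundle_apply₂ (F₁ := EuclideanSpace ℝ (Fin n))
      (F₂ := EuclideanSpace ℝ (Fin n)) (hb p)
      (contMDiffAt_coordField p u) (contMDiffAt_coordField p v)
  rw [contMDiffAt_section] at h
  exact differentiableAt_chart_symm (h.mdifferentiableAt (by simp))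

theorem EndField.IsSmooth.differentiableAt_coordEnd {J : EndField n M} (hJ : J.IsSmooth)
    (p : M) : DifferentiableAt ℝ (coordEnd J p) (chartAt (EuclideanSpace ℝ (Fin n)) p p) := by
  refine differentiableAt_clm_of_apply fun u => ?_
  have h : ContMDiffAt (𝓡 n) ((𝓡 n).prod 𝓘(ℝ, EuclideanSpace ℝ (Fin n))) ∞
      (fun x => TotalSpace.mk' (EuclideanSpace ℝ (Fin n)) x (J x (ofCoord n M p x u))) p :=
    ContMDiffAt.clm_bundle_apply (F₁ := EuclideanSpace ℝ (Fin n)) (hJ p)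
      (contMDiffAt_coordField p u)
  rw [contMDiffAt_section] at h
  refine (differentiableAt_chart_symm (h.mdifferentiableAt (by simp))).congr_of_eventuallyEq ?_
  filter_upwards [(tendsto_chart_symm (n := n) p).eventually (eventually_mem_chart_source (n := n) p)]
    with y hy
  simp only [coordEnd, ContinuousLinearMap.comp_apply, Function.comp_apply]
  rw [toCoord, Trivialization.continuousLinearMapAt_apply,
    Trivialization.coe_linearMapAt_of_mem _ (by simpa using hy)]

end Chart

/-! ### The Levi-Civita connection in coordinates. -/

section Connection

variable {n : ℕ} {M : Type*} [TopologicalSpace M] [ChartedSpace (EuclideanSpace ℝ (Fin n)) M]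
  [IsManifold (𝓡 n) ∞ M]

/-- The metric at a point, on the model space. -/
def metricAt (g : Metric n M) (q : M) :
    EuclideanSpace ℝ (Fin n) →L[ℝ] EuclideanSpace ℝ (Fin n) →L[ℝ] ℝ := g.inner q

/-- The Christoffel symbols at a point, on the model space. -/
def christoffelAt (g : Metric n M) (q : M) (u v : EuclideanSpace ℝ (Fin n)) :
    EuclideanSpace ℝ (Fin n) := christoffel g q u v

theorem metricAt_symm (g : Metric n M) (q : M) (u v : EuclideanSpace ℝ (Fin n)) :
    metricAt g q u v = metricAt g q v u := g.symm q u v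

theorem metricAt_pos (g : Metric n M) (q : M) (u : EuclideanSpace ℝ (Fin n)) (hu : u ≠ 0) :
    0 < metricAt g q u u := g.pos q u hu

theorem metricAt_injective (g : Metric n M) (q : M) {u v : EuclideanSpace ℝ (Fin n)}
    (h : ∀ w, metricAt g q u w = metricAt g q v w) : u = v := by
  by_contra hne
  have := metricAt_pos g q (u - v) (sub_ne_zero.mpr hne)
  rw [map_sub (metricAt g q), sub_apply, h, sub_self] at this
  exact lt_irrefl _ this

/-- The derivative of the metric in the chart at `q`. -/
def metricDeriv (g : Metric n M) (q : M) : EuclideanSpace ℝ (Fin n) →L[ℝ]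
    EuclideanSpace ℝ (Fin n) →L[ℝ] EuclideanSpace ℝ (Fin n) →L[ℝ] ℝ :=
  fderiv ℝ (coordForm g.inner q) (chartAt (EuclideanSpace ℝ (Fin n)) q q)

theorem differentiableAt_coordForm_metric (g : Metric n M) (q : M) :
    DifferentiableAt ℝ (coordForm g.inner q) (chartAt (EuclideanSpace ℝ (Fin n)) q q) :=
  BilinField.IsSmooth.differentiableAt_coordForm g.contMDiff q

theorem fderiv_apply_apply {D E F G : Type*} [NormedAddCommGroup D] [NormedSpace ℝ D]
    [NormedAddCommGroup E] [NormedSpace ℝ E] [NormedAddCommGroup F] [NormedSpace ℝ F]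
    [NormedAddCommGroup G] [NormedSpace ℝ G]
    {B : D → E →L[ℝ] F →L[ℝ] G} {y : D} (hB : DifferentiableAt ℝ B y) (w : D) (u : E) (v : F) :
    fderiv ℝ (fun y => B y u v) y w = fderiv ℝ B y w u v := by
  rw [fderiv_clm_apply (hB.clm_apply (differentiableAt_const u)) (differentiableAt_const v),
    fderiv_clm_apply hB (differentiableAt_const u)]
  simp

theorem metricCoordDeriv_eq (g : Metric n M) (q : M) (w u v : EuclideanSpace ℝ (Fin n)) :
    metricCoordDeriv g q w u v = metricDeriv g q w u v := by
  have hB := differentiableAt_coordForm_metric g q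
  rw [metricDeriv, ← fderiv_apply_apply hB]
  exact mfderiv_apply_eq_fderiv_chart (M := M) (n := n) (p := q)
    (φ := fun x => g.inner x (coordField q u x) (coordField q v x))
    (φ' := fun y => coordForm g.inner q y u v)
    (Filter.Eventually.of_forall fun y => (coordForm_apply g.inner q y u v).symm)
    ((hB.clm_apply (differentiableAt_const u)).clm_apply (differentiableAt_const v)) w

theorem metricDeriv_symm (g : Metric n M) (q : M) (w u v : EuclideanSpace ℝ (Fin n)) :
    metricDeriv g q w u v = metricDeriv g q w v u := by
  have hB := differentiableAt_coordForm_metric g q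
  rw [metricDeriv, ← fderiv_apply_apply hB, ← fderiv_apply_apply hB]
  congr 2
  funext y
  rw [coordForm_apply, coordForm_apply]
  exact g.symm _ _ _

theorem metricAt_christoffelAt (g : Metric n M) (q : M) (u v w : EuclideanSpace ℝ (Fin n)) :
    metricAt g q (christoffelAt g q u v) w =
      (metricDeriv g q u v w + metricDeriv g q v u w - metricDeriv g q w u v) / 2 := by
  -- The Koszul expression is packaged as a linear form in w, as `dualVector_spec` requires; the two
  -- flips bring the differentiation slot to the last position.
  let ℓ : EuclideanSpace ℝ (Fin n) →ₗ[ℝ] ℝ :=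
    (1 / 2 : ℝ) • ((metricDeriv g q u v : _ →ₗ[ℝ] ℝ) + (metricDeriv g q v u : _ →ₗ[ℝ] ℝ)
      - (((metricDeriv g q).flip u).flip v : _ →ₗ[ℝ] ℝ))
  have hℓ : ∀ w, ℓ w =
      (metricDeriv g q u v w + metricDeriv g q v u w - metricDeriv g q w u v) / 2 := by
    intro w
    simp [ℓ]
    ring
  have h := dualVector_spec (metricAt g q).toLinearMap₁₂
    (fun w hw => metricAt_injective g q (v := 0) fun v => by simpa using hw v) ℓ w
  rw [← hℓ, ← h]
  have hc : christoffelAt g q u v =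
      dualVector (fun w v => (metricAt g q).toLinearMap₁₂ w v) (fun w => ℓ w) := by
    simp only [hℓ, ← metricCoordDeriv_eq]
    rfl
  rw [hc]
  rfl

theorem christoffelAt_symm (g : Metric n M) (q : M) (u v : EuclideanSpace ℝ (Fin n)) :
    christoffelAt g q u v = christoffelAt g q v u := by
  refine metricAt_injective g q fun w => ?_
  rw [metricAt_christoffelAt, metricAt_christoffelAt, metricDeriv_symm g q w u v]
  ring

/-- The Levi-Civita connection is metric. -/
theorem metricDeriv_eq (g : Metric n M) (q : M) (u v w : EuclideanSpace ℝ (Fin n)) :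
    metricDeriv g q u v w = metricAt g q (christoffelAt g q u v) w
      + metricAt g q v (christoffelAt g q u w) := by
  rw [metricAt_symm g q v, metricAt_christoffelAt, metricAt_christoffelAt,
    metricDeriv_symm g q u w v, metricDeriv_symm g q w u v]
  ring

/-- Parallelism is tested on the coordinate field with value v. Its coefficients are constant, so
only the derivative of J and the Christoffel terms survive. -/
theorem IsParallel.fderiv_coordEnd {g : Metric n M} {J : EndField n M} (hJ : J.IsSmooth)
    (h : IsParallel g J) (q : M) (u v : EuclideanSpace ℝ (Fin n)) :
    fderiv ℝ (coordEnd J q) (chartAt (EuclideanSpace ℝ (Fin n)) q q) u v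
        + christoffelAt g q u (J q v)
      = J q (christoffelAt g q u v) := by
  have hJ' := hJ.differentiableAt_coordEnd q
  have hv := h q u (fun x => ofCoord n M q x v)
    ((contMDiffAt_coordField q v).mdifferentiableAt (by simp))
  have h1 : mfderiv (𝓡 n) 𝓘(ℝ, EuclideanSpace ℝ (Fin n))
      (fun x => toCoord n M q x (J x (ofCoord n M q x v))) q u
      = fderiv ℝ (coordEnd J q) (chartAt (EuclideanSpace ℝ (Fin n)) q q) u v := by
    refine (mfderiv_apply_eq_fderiv_chart (M := M) (n := n) (p := q)
      (φ := fun x => toCoord n M q x (J x (ofCoord n M q x v)))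
      (φ' := fun y => coordEnd J q y v) (Filter.EventuallyEq.rfl)
      (hJ'.clm_apply (differentiableAt_const v)) u).trans ?_
    rw [fderiv_clm_apply hJ' (differentiableAt_const v)]
    simp
    rfl
  have h2 : mfderiv (𝓡 n) 𝓘(ℝ, EuclideanSpace ℝ (Fin n))
      (fun x => toCoord n M q x (ofCoord n M q x v)) q u = 0 := by
    refine (mfderiv_apply_eq_fderiv_chart (M := M) (n := n) (p := q)
      (φ := fun x => toCoord n M q x (ofCoord n M q x v))
      (φ' := fun _ => v) (by
        filter_upwards [(tendsto_chart_symm (n := n) q).eventually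
          (eventually_mem_chart_source (n := n) q)] with y hy
        exact toCoord_ofCoord hy v) (differentiableAt_const v) u).trans ?_
    simp
    rfl
  have hpush : push (m := n) (n := n) (id : M → M) q u = u := by
    rw [push, mfderiv_id]; rfl
  unfold covDerivAlong at hv
  simp only [id_eq] at hv
  rw [hpush] at hv
  erw [h1, h2, ofCoord_self] at hv
  exact hv.trans (congrArg (J q) (zero_add (christoffelAt g q u v)))

end Connection

/-! ### The differential of a map in charts. -/

section Maps

variable {m n : ℕ}
  {S : Type*} [TopologicalSpace S] [ChartedSpace (EuclideanSpace ℝ (Fin m)) S]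
  {M : Type*} [TopologicalSpace M] [ChartedSpace (EuclideanSpace ℝ (Fin n)) M]

variable (m n) in
/-- The map `f` in the charts at `p` and `f p`. -/
def coordMap (f : S → M) (p : S) : EuclideanSpace ℝ (Fin m) → EuclideanSpace ℝ (Fin n) :=
  chartAt (EuclideanSpace ℝ (Fin n)) (f p) ∘ f ∘ (chartAt (EuclideanSpace ℝ (Fin m)) p).symm

theorem coordMap_chart (f : S → M) (p : S) :
    coordMap m n f p (chartAt (EuclideanSpace ℝ (Fin m)) p p)
      = chartAt (EuclideanSpace ℝ (Fin n)) (f p) (f p) := by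
  simp [coordMap]

theorem contDiffAt_coordMap {f : S → M} {p : S} (hf : ContMDiffAt (𝓡 m) (𝓡 n) ∞ f p) :
    ContDiffAt ℝ ∞ (coordMap m n f p) (chartAt (EuclideanSpace ℝ (Fin m)) p p) := by
  have h := (contMDiffAt_iff.mp hf).2
  simp only [mfld_simps] at h
  exact contDiffWithinAt_univ.mp h

theorem eventually_mem_sources {f : S → M} {p : S} (hf : ContinuousAt f p) :
    ∀ᶠ y in 𝓝 (chartAt (EuclideanSpace ℝ (Fin m)) p p),
      y ∈ (chartAt (EuclideanSpace ℝ (Fin m)) p).target ∧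
      (chartAt (EuclideanSpace ℝ (Fin m)) p).symm y ∈
        (chartAt (EuclideanSpace ℝ (Fin m)) p).source ∧
      f ((chartAt (EuclideanSpace ℝ (Fin m)) p).symm y) ∈
        (chartAt (EuclideanSpace ℝ (Fin n)) (f p)).source := by
  have h1 := (chartAt (EuclideanSpace ℝ (Fin m)) p).open_target.mem_nhds
    ((chartAt (EuclideanSpace ℝ (Fin m)) p).map_source (mem_chart_source _ p))
  filter_upwards [h1, (hf.tendsto.comp (tendsto_chart_symm (n := m) p)).eventually
    (eventually_mem_chart_source (n := n) (f p))] with y hy hy'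
  exact ⟨hy, (chartAt (EuclideanSpace ℝ (Fin m)) p).map_target hy, hy'⟩

variable [IsManifold (𝓡 m) ∞ S] [IsManifold (𝓡 n) ∞ M]

/-- This is the chain rule: `toCoord` is the differential of the chart at f p and `ofCoord` that of
the inverse chart at p. It is needed at all x near p, since the result is differentiated once more.
-/
theorem toCoord_push_ofCoord {f : S → M} {p x : S}
    (hx : x ∈ (chartAt (EuclideanSpace ℝ (Fin m)) p).source)
    (hfx : f x ∈ (chartAt (EuclideanSpace ℝ (Fin n)) (f p)).source)
    (hf : MDifferentiableAt (𝓡 m) (𝓡 n) f x) (u : EuclideanSpace ℝ (Fin m)) :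
    toCoord n M (f p) (f x) (push f x (ofCoord m S p x u))
      = fderiv ℝ (coordMap m n f p) (chartAt (EuclideanSpace ℝ (Fin m)) p x) u := by
  have : IsManifold (𝓡 n) 1 M := IsManifold.of_le (n := ∞) (by simp)
  have : IsManifold (𝓡 m) 1 S := IsManifold.of_le (n := ∞) (by simp)
  have hφ := (mdifferentiableAt_extChartAt (I := 𝓡 n) hfx).hasMFDerivAt
  have hψ := (mdifferentiableWithinAt_extChartAt_symm (I := 𝓡 m) (x := p)
    (z := extChartAt (𝓡 m) p x)
    ((extChartAt (𝓡 m) p).map_source (by simpa using hx))).hasMFDerivWithinAt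
  have hxx : (extChartAt (𝓡 m) p).symm (extChartAt (𝓡 m) p x) = x :=
    (extChartAt (𝓡 m) p).left_inv (by simpa using hx)
  have hf' := hf.hasMFDerivAt
  rw [toCoord, TangentBundle.continuousLinearMapAt_trivializationAt hfx, ofCoord,
    TangentBundle.symmL_trivializationAt hx]
  have hcomp : HasMFDerivAt (𝓡 m) (𝓡 n) f ((extChartAt (𝓡 m) p).symm (extChartAt (𝓡 m) p x))
      (push f x) := by rw [hxx]; exact hf'
  have hcomp2 : HasMFDerivAt (𝓡 n) 𝓘(ℝ, EuclideanSpace ℝ (Fin n)) (extChartAt (𝓡 n) (f p))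
      (f ((extChartAt (𝓡 m) p).symm (extChartAt (𝓡 m) p x)))
      (mfderiv (𝓡 n) 𝓘(ℝ, EuclideanSpace ℝ (Fin n)) (extChartAt (𝓡 n) (f p)) (f x)) := by
    rw [hxx]; exact hφ
  have h := hcomp2.comp_hasMFDerivWithinAt (extChartAt (𝓡 m) p x)
    (f := f ∘ (extChartAt (𝓡 m) p).symm)
    (hcomp.comp_hasMFDerivWithinAt (extChartAt (𝓡 m) p x) hψ)
  -- The three differentials are retyped on the model spaces, so that the manifold derivative can be
  -- read as a Fréchet derivative.
  let A : EuclideanSpace ℝ (Fin n) →L[ℝ] EuclideanSpace ℝ (Fin n) :=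
    mfderiv (𝓡 n) 𝓘(ℝ, EuclideanSpace ℝ (Fin n)) (extChartAt (𝓡 n) (f p)) (f x)
  let B : EuclideanSpace ℝ (Fin m) →L[ℝ] EuclideanSpace ℝ (Fin n) := push f x
  let C : EuclideanSpace ℝ (Fin m) →L[ℝ] EuclideanSpace ℝ (Fin m) :=
    mfderivWithin 𝓘(ℝ, EuclideanSpace ℝ (Fin m)) (𝓡 m) (extChartAt (𝓡 m) p).symm
      (Set.range (𝓡 m)) (extChartAt (𝓡 m) p x)
  have h' : HasFDerivWithinAt (coordMap m n f p) (A ∘L B ∘L C) (Set.range (𝓡 m))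
      (chartAt (EuclideanSpace ℝ (Fin m)) p x) :=
    (hasMFDerivWithinAt_iff_hasFDerivWithinAt (f' := A ∘L B ∘L C)).mp h
  have hr : Set.range (𝓡 m) = Set.univ := by simp only [mfld_simps]
  rw [hr] at h'
  rw [(hasFDerivWithinAt_univ.mp h').fderiv]
  rfl

end Maps

/-! ### Parallel bilinear forms. -/

section ParallelForms

variable {n : ℕ} {M : Type*} [TopologicalSpace M] [ChartedSpace (EuclideanSpace ℝ (Fin n)) M]
  [IsManifold (𝓡 n) ∞ M]

/-- A bilinear form field at a point, on the model space. -/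
def formAt (b : BilinField n M) (q : M) :
    EuclideanSpace ℝ (Fin n) →L[ℝ] EuclideanSpace ℝ (Fin n) →L[ℝ] ℝ := b q

/-- An endomorphism field at a point, on the model space. -/
def endAt (J : EndField n M) (q : M) :
    EuclideanSpace ℝ (Fin n) →L[ℝ] EuclideanSpace ℝ (Fin n) := J q

/-- In the chart at each point `q`, the form `b` is differentiable with vanishing covariant
derivative at `q`. -/
structure IsParallelForm (g : Metric n M) (b : BilinField n M) : Prop where
  differentiableAt : ∀ q, DifferentiableAt ℝ (coordForm b q)
    (chartAt (EuclideanSpace ℝ (Fin n)) q q)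
  fderiv_eq : ∀ q (u v w : EuclideanSpace ℝ (Fin n)),
    fderiv ℝ (coordForm b q) (chartAt (EuclideanSpace ℝ (Fin n)) q q) u v w
      = formAt b q (christoffelAt g q u v) w + formAt b q v (christoffelAt g q u w)

theorem isParallelForm_metric (g : Metric n M) : IsParallelForm g g.inner where
  differentiableAt := differentiableAt_coordForm_metric g
  fderiv_eq := metricDeriv_eq g

theorem coordForm_kahlerForm_eventuallyEq (g : Metric n M) (J : EndField n M) (q : M) :
    coordForm (kahlerForm g J) q
      =ᶠ[𝓝 (chartAt (EuclideanSpace ℝ (Fin n)) q q)]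
        fun y => (coordForm g.inner q y).comp (coordEnd J q y) := by
  filter_upwards [(tendsto_chart_symm (n := n) q).eventually
    (eventually_mem_chart_source (n := n) q)] with y hy
  ext u v
  rw [ContinuousLinearMap.comp_apply, coordForm_apply, coordForm_apply, coordEnd]
  simp only [ContinuousLinearMap.comp_apply]
  rw [ofCoord_toCoord hy]
  rfl

/-- Differentiating g(J v, w) by the product rule, the term g(Γ(u, J v), w) from the derivative of g
cancels the one from the derivative of J. -/
theorem IsKahler.isParallelForm {g : Metric n M} {J : EndField n M} (hJ : IsKahler g J) :
    IsParallelForm g (kahlerForm g J) := by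
  have hd (q : M) := (differentiableAt_coordForm_metric g q).clm_comp
    (hJ.smooth.differentiableAt_coordEnd q)
  refine ⟨fun q => (hd q).congr_of_eventuallyEq
    (coordForm_kahlerForm_eventuallyEq g J q), fun q u v w => ?_⟩
  have hg := differentiableAt_coordForm_metric g q
  have hJ' := hJ.smooth.differentiableAt_coordEnd q
  rw [(coordForm_kahlerForm_eventuallyEq g J q).fderiv_eq, fderiv_clm_comp hg hJ']
  have h1 : coordEnd J q (chartAt (EuclideanSpace ℝ (Fin n)) q q) = endAt J q :=
    ContinuousLinearMap.ext (coordEnd_chart J q)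
  have h2 : coordForm g.inner q (chartAt (EuclideanSpace ℝ (Fin n)) q q) = metricAt g q :=
    ContinuousLinearMap.ext fun v => ContinuousLinearMap.ext (coordForm_chart g.inner q v)
  have h3 := IsParallel.fderiv_coordEnd hJ.smooth hJ.parallel q u v
  have h4 : fderiv ℝ (coordEnd J q) (chartAt (EuclideanSpace ℝ (Fin n)) q q) u v
      = endAt J q (christoffelAt g q u v) - christoffelAt g q u (endAt J q v) :=
    eq_sub_of_add_eq h3
  have h5 : fderiv ℝ (coordForm g.inner q) (chartAt (EuclideanSpace ℝ (Fin n)) q q) u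
      (endAt J q v) w = _ := metricDeriv_eq g q u (endAt J q v) w
  have h6 (u v : EuclideanSpace ℝ (Fin n)) :
    formAt (kahlerForm g J) q u v = metricAt g q (endAt J q u) v := rfl
  simp only [add_apply, ContinuousLinearMap.comp_apply, ContinuousLinearMap.compL_apply,
    ContinuousLinearMap.flip_apply, h1, h2, h4, h5, h6, map_sub, sub_apply]
  ring

end ParallelForms

/-! ### The covariant Hessian of a map and derivatives of pulled-back forms. -/

section Maps

variable {m n : ℕ}
  {S : Type*} [TopologicalSpace S] [ChartedSpace (EuclideanSpace ℝ (Fin m)) S]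
  [IsManifold (𝓡 m) ∞ S]
  {M : Type*} [TopologicalSpace M] [ChartedSpace (EuclideanSpace ℝ (Fin n)) M]
  [IsManifold (𝓡 n) ∞ M]

variable (m n) in
/-- The differential of a map at a point, on the model spaces. -/
def pushAt (f : S → M) (p : S) : EuclideanSpace ℝ (Fin m) →L[ℝ] EuclideanSpace ℝ (Fin n) :=
  push f p

theorem fderiv_coordMap {f : S → M} {p : S} (hf : MDifferentiableAt (𝓡 m) (𝓡 n) f p) :
    fderiv ℝ (coordMap m n f p) (chartAt (EuclideanSpace ℝ (Fin m)) p p) = pushAt m n f p := by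
  ext1 u
  rw [← toCoord_push_ofCoord (mem_chart_source _ p) (mem_chart_source _ (f p)) hf, toCoord_self,
    ofCoord_self]
  rfl

/-- The second covariant derivative `∇̄_u f_* ∂_v`, where `∂_v` is a coordinate vector field. -/
def covHessian (g : Metric n M) (f : S → M) (p : S) (u v : EuclideanSpace ℝ (Fin m)) :
    EuclideanSpace ℝ (Fin n) :=
  fderiv ℝ (fderiv ℝ (coordMap m n f p)) (chartAt (EuclideanSpace ℝ (Fin m)) p p) u v
    + christoffelAt g (f p) (pushAt m n f p u) (pushAt m n f p v)

/-- Second derivatives commute and the connection is torsion-free. -/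
theorem covHessian_symm (g : Metric n M) {f : S → M} {p : S}
    (hf : ContMDiffAt (𝓡 m) (𝓡 n) ∞ f p) (u v : EuclideanSpace ℝ (Fin m)) :
    covHessian g f p u v = covHessian g f p v u := by
  rw [covHessian, covHessian, christoffelAt_symm]
  congr 1
  exact (contDiffAt_coordMap hf).isSymmSndFDerivAt
    (by rw [minSmoothness_of_isRCLikeNormedField]; exact ENat.LEInfty.out) u v

theorem differentiableAt_fderiv_coordMap {f : S → M} {p : S}
    (hf : ContMDiffAt (𝓡 m) (𝓡 n) ∞ f p) :
    DifferentiableAt ℝ (fderiv ℝ (coordMap m n f p))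
      (chartAt (EuclideanSpace ℝ (Fin m)) p p) :=
  ((contDiffAt_coordMap hf).fderiv_right (m := 1)
    (by rw [one_add_one_eq_two]; exact ENat.LEInfty.out)).differentiableAt (by simp)

/-- Near p the coordinates of f_*∂_v are the derivative of `coordMap` in the direction v, so their
derivative at p is a second derivative. -/
theorem covDerivAlong_push_coordField (g : Metric n M) {f : S → M}
    (hf : ContMDiff (𝓡 m) (𝓡 n) ∞ f) (p : S) (u v : EuclideanSpace ℝ (Fin m)) :
    covDerivAlong g f (fun x => push f x (coordField p v x)) p u = covHessian g f p u v := by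
  have hmd := hf.mdifferentiable (by simp)
  have hd := differentiableAt_fderiv_coordMap (hf p)
  have h1 : mfderiv (𝓡 m) 𝓘(ℝ, EuclideanSpace ℝ (Fin n))
      (fun x => toCoord n M (f p) (f x) (push f x (ofCoord m S p x v))) p u
      = fderiv ℝ (fderiv ℝ (coordMap m n f p))
        (chartAt (EuclideanSpace ℝ (Fin m)) p p) u v := by
    refine (mfderiv_apply_eq_fderiv_chart (M := S) (n := m) (p := p)
      (φ := fun x => toCoord n M (f p) (f x) (push f x (ofCoord m S p x v)))
      (φ' := fun y => fderiv ℝ (coordMap m n f p) y v) ?_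
      (hd.clm_apply (differentiableAt_const v)) u).trans ?_
    · filter_upwards [eventually_mem_sources (n := n) (hf.continuous.continuousAt (x := p))]
        with y hy
      rw [Function.comp_apply, toCoord_push_ofCoord hy.2.1 hy.2.2 (hmd _),
        OpenPartialHomeomorph.right_inv _ hy.1]
    · rw [fderiv_clm_apply hd (differentiableAt_const v)]
      simp
      rfl
  have h2 : push f p (coordField p v p) = pushAt m n f p v :=
    congrArg (pushAt m n f p) (ofCoord_self p v)
  unfold covDerivAlong
  simp only [h2]
  exact congrArg (fun z : EuclideanSpace ℝ (Fin n) =>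
    z + christoffelAt g (f p) (pushAt m n f p u) (pushAt m n f p v)) h1

/-- The pullback of a bilinear form field, in the charts at `p` and `f p`. -/
def coordPullback (b : BilinField n M) (f : S → M) (p : S) (v w y : EuclideanSpace ℝ (Fin m)) :
    ℝ :=
  coordForm b (f p) (coordMap m n f p y) (fderiv ℝ (coordMap m n f p) y v)
    (fderiv ℝ (coordMap m n f p) y w)

theorem pullback_ofCoord_eventuallyEq (b : BilinField n M) {f : S → M}
    (hf : ContMDiff (𝓡 m) (𝓡 n) ∞ f) (p : S) (v w : EuclideanSpace ℝ (Fin m)) :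
    (fun x => pullback f b x (ofCoord m S p x v) (ofCoord m S p x w))
        ∘ (chartAt (EuclideanSpace ℝ (Fin m)) p).symm
      =ᶠ[𝓝 (chartAt (EuclideanSpace ℝ (Fin m)) p p)] coordPullback b f p v w := by
  have hmd := hf.mdifferentiable (by simp)
  filter_upwards [eventually_mem_sources (n := n) (hf.continuous.continuousAt (x := p))] with y hy
  have h (v : EuclideanSpace ℝ (Fin m)) := toCoord_push_ofCoord hy.2.1 hy.2.2 (hmd _) v
  rw [OpenPartialHomeomorph.right_inv _ hy.1] at h
  have hs : (chartAt (EuclideanSpace ℝ (Fin n)) (f p)).symm (coordMap m n f p y)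
      = f ((chartAt (EuclideanSpace ℝ (Fin m)) p).symm y) :=
    (chartAt (EuclideanSpace ℝ (Fin n)) (f p)).left_inv hy.2.2
  rw [coordPullback, coordForm_apply, hs, ← h, ← h, ofCoord_toCoord hy.2.2,
    ofCoord_toCoord hy.2.2]
  rfl

theorem coordPullback_chart (b : BilinField n M) {f : S → M} {p : S}
    (hf : MDifferentiableAt (𝓡 m) (𝓡 n) f p) (v w : EuclideanSpace ℝ (Fin m)) :
    coordPullback b f p v w (chartAt (EuclideanSpace ℝ (Fin m)) p p)
      = formAt b (f p) (pushAt m n f p v) (pushAt m n f p w) := by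
  rw [coordPullback, coordMap_chart, fderiv_coordMap hf]
  exact coordForm_chart b (f p) _ _

/-- By the chain rule the form is differentiated in the direction f_*u. Parallelism turns this into
Christoffel terms, which complete the ordinary second derivatives of f to covariant ones. -/
theorem IsParallelForm.fderiv_coordPullback {g : Metric n M} {b : BilinField n M}
    (hb : IsParallelForm g b) {f : S → M} {p : S} (hf : ContMDiffAt (𝓡 m) (𝓡 n) ∞ f p)
    (v w : EuclideanSpace ℝ (Fin m)) :
    DifferentiableAt ℝ (coordPullback b f p v w) (chartAt (EuclideanSpace ℝ (Fin m)) p p) ∧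
    ∀ u, fderiv ℝ (coordPullback b f p v w) (chartAt (EuclideanSpace ℝ (Fin m)) p p) u
      = formAt b (f p) (covHessian g f p u v) (pushAt m n f p w)
        + formAt b (f p) (pushAt m n f p v) (covHessian g f p u w) := by
  have hmd := hf.mdifferentiableAt (by simp)
  have hF : DifferentiableAt ℝ (coordMap m n f p) (chartAt (EuclideanSpace ℝ (Fin m)) p p) :=
    (contDiffAt_coordMap hf).differentiableAt (by simp)
  have hd := differentiableAt_fderiv_coordMap hf
  have hB : DifferentiableAt ℝ (coordForm b (f p))
      (coordMap m n f p (chartAt (EuclideanSpace ℝ (Fin m)) p p)) := by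
    rw [coordMap_chart]; exact hb.differentiableAt (f p)
  have hBF := hB.comp _ hF
  have hv := hd.clm_apply (differentiableAt_const v)
  have hw := hd.clm_apply (differentiableAt_const w)
  refine ⟨(hBF.clm_apply hv).clm_apply hw, fun u => ?_⟩
  have e : coordPullback b f p v w = fun y => ((coordForm b (f p) ∘ coordMap m n f p) y
    (fderiv ℝ (coordMap m n f p) y v)) (fderiv ℝ (coordMap m n f p) y w) := rfl
  have h2 : coordForm b (f p) (chartAt (EuclideanSpace ℝ (Fin n)) (f p) (f p))
      = formAt b (f p) :=
    ContinuousLinearMap.ext fun v => ContinuousLinearMap.ext (coordForm_chart b (f p) v)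
  rw [e, fderiv_clm_apply (hBF.clm_apply hv) hw, fderiv_clm_apply hBF hv,
    fderiv_clm_apply hd (differentiableAt_const v), fderiv_clm_apply hd (differentiableAt_const w),
    fderiv_comp _ hB hF, fderiv_coordMap hmd]
  simp only [Function.comp_apply, coordMap_chart, h2]
  simp only [add_apply, ContinuousLinearMap.comp_apply, ContinuousLinearMap.flip_apply,
    fderiv_fun_const, Pi.zero_apply, zero_apply, map_zero, zero_add,
    hb.fderiv_eq, covHessian, map_add]
  ring

end Maps

/-! ### Linear algebra of the plane: ratios of area forms and explicit dual vectors. -/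

section Planar

/-- The Gram determinant of two vectors. -/
def gram {V : Type*} (B : V → V → ℝ) (u v : V) : ℝ := B u u * B v v - B u v ^ 2

variable {α β B : EuclideanSpace ℝ (Fin 2) →L[ℝ] EuclideanSpace ℝ (Fin 2) →L[ℝ] ℝ}

/-- The standard basis of the plane. -/
abbrev stdVec (i : Fin 2) : EuclideanSpace ℝ (Fin 2) := EuclideanSpace.single i 1

theorem eq_add_stdVec (u : EuclideanSpace ℝ (Fin 2)) :
    u = u 0 • stdVec 0 + u 1 • stdVec 1 := by
  ext i
  fin_cases i <;> simp

theorem swap_of_alternating (hα : ∀ v, α v v = 0) (u v : EuclideanSpace ℝ (Fin 2)) :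
    α u v = -α v u := by
  have h := hα (u + v)
  simp only [map_add, add_apply, hα] at h
  linarith

theorem alternating_apply (hα : ∀ v, α v v = 0) (u v : EuclideanSpace ℝ (Fin 2)) :
    α u v = (u 0 * v 1 - u 1 * v 0) * α (stdVec 0) (stdVec 1) := by
  conv_lhs => rw [eq_add_stdVec u, eq_add_stdVec v]
  simp only [map_add, map_smul, add_apply, smul_apply, hα, smul_eq_mul,
    swap_of_alternating hα (stdVec 1) (stdVec 0)]
  ring

theorem alternating_stdVec_ne_zero (hα : ∀ v, α v v = 0) (h : α ≠ 0) :
    α (stdVec 0) (stdVec 1) ≠ 0 := fun h0 => h <|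
  ContinuousLinearMap.ext fun u => ContinuousLinearMap.ext fun v => by
    rw [alternating_apply hα, h0, mul_zero]; rfl

theorem gram_apply (hB : ∀ u v, B u v = B v u) (u v : EuclideanSpace ℝ (Fin 2)) :
    gram (fun u v => B u v) u v
      = (u 0 * v 1 - u 1 * v 0) ^ 2 * gram (fun u v => B u v) (stdVec 0) (stdVec 1) := by
  have key (a b c d : ℝ) : gram (fun u v => B u v) (a • stdVec 0 + b • stdVec 1)
      (c • stdVec 0 + d • stdVec 1)
      = (a * d - b * c) ^ 2 * gram (fun u v => B u v) (stdVec 0) (stdVec 1) := by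
    simp only [gram, map_add, map_smul, add_apply, smul_apply, smul_eq_mul,
      hB (stdVec 1) (stdVec 0)]
    ring
  have h := key (u 0) (u 1) (v 0) (v 1)
  rwa [← eq_add_stdVec u, ← eq_add_stdVec v] at h

theorem det_ne_zero_of_injective
    {T : EuclideanSpace ℝ (Fin 2) →L[ℝ] EuclideanSpace ℝ (Fin 2)} (hT : Function.Injective T) :
    T (stdVec 0) 0 * T (stdVec 1) 1 - T (stdVec 0) 1 * T (stdVec 1) 0 ≠ 0 := by
  intro h
  set a := T (stdVec 0) with ha
  set b := T (stdVec 1) with hb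
  have key (c d : ℝ) (h : c • a + d • b = 0) : c = 0 ∧ d = 0 := by
    have h0 : c • stdVec 0 + d • stdVec 1 = 0 := hT (by simpa using h)
    have e0 := congrArg (fun x => x 0) h0
    have e1 := congrArg (fun x => x 1) h0
    simp at e0 e1
    exact ⟨e0, e1⟩
  -- If the determinant vanishes, b₁ a - a₁ b and b₀ a - a₀ b are both zero. Independence of a, b
  -- then gives b₁ = b₀ = 0, hence b = 0, a contradiction.
  have k1 := key (b 1) (-a 1) (by
    ext i
    fin_cases i
    · simp; linarith
    · simp; ring)
  have k0 := key (b 0) (-a 0) (by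
    ext i
    fin_cases i
    · simp; ring
    · simp; linarith)
  have hb0 : b = 0 := by
    ext i
    fin_cases i
    · exact k0.1
    · exact k1.1
  simpa using key 0 1 (by simp [hb0])

/-- The quotient of two alternating forms of the plane does not depend on the basis. -/
theorem alternating_ratio_comp (hα : ∀ v, α v v = 0) (hβ : ∀ v, β v v = 0)
    {T : EuclideanSpace ℝ (Fin 2) →L[ℝ] EuclideanSpace ℝ (Fin 2)} (hT : Function.Injective T) :
    α (stdVec 0) (stdVec 1) / β (stdVec 0) (stdVec 1)
      = α (T (stdVec 0)) (T (stdVec 1)) / β (T (stdVec 0)) (T (stdVec 1)) := by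
  rw [alternating_apply hα (T _), alternating_apply hβ (T _),
    mul_div_mul_left _ _ (det_ne_zero_of_injective hT)]

/-- The quotient of the signed area by an alternating form does not depend on the basis. -/
theorem area_ratio_comp (hB : ∀ u v, B u v = B v u) (hβ : ∀ v, β v v = 0) (hβ0 : β ≠ 0)
    {T : EuclideanSpace ℝ (Fin 2) →L[ℝ] EuclideanSpace ℝ (Fin 2)} (hT : Function.Injective T) :
    (SignType.sign (β (stdVec 0) (stdVec 1)) : ℝ)
        * √(gram (fun u v => B u v) (stdVec 0) (stdVec 1)) / β (stdVec 0) (stdVec 1)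
      = √(gram (fun u v => B u v) (T (stdVec 0)) (T (stdVec 1))
          / β (T (stdVec 0)) (T (stdVec 1)) ^ 2) := by
  rw [gram_apply hB (T _), alternating_apply hβ (T _), mul_pow,
    mul_div_mul_left _ _ (pow_ne_zero 2 (det_ne_zero_of_injective hT)),
    Real.sqrt_div' _ (sq_nonneg _), Real.sqrt_sq_eq_abs]
  -- In either orientation sign(β) / β = 1 / |β|, which absorbs the sign into the square root.
  have h0 := alternating_stdVec_ne_zero hβ hβ0
  rcases lt_or_gt_of_ne h0 with h | h
  · rw [sign_neg h, abs_of_neg h]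
    simp [div_neg, neg_div]
  · rw [sign_pos h, abs_of_pos h]
    simp

theorem gram_pos_of_injective {n : ℕ}
    {G : EuclideanSpace ℝ (Fin n) →L[ℝ] EuclideanSpace ℝ (Fin n) →L[ℝ] ℝ}
    (hG : ∀ v w, G v w = G w v) (hpos : ∀ v, v ≠ 0 → 0 < G v v)
    {P : EuclideanSpace ℝ (Fin 2) →L[ℝ] EuclideanSpace ℝ (Fin n)} (hP : Function.Injective P) :
    0 < gram (fun u v => G u v) (P (stdVec 0)) (P (stdVec 1)) := by
  set a := P (stdVec 0) with ha
  set b := P (stdVec 1) with hb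
  have key (c d : ℝ) (h : c • a + d • b = 0) : c = 0 ∧ d = 0 := by
    have h0 : c • stdVec 0 + d • stdVec 1 = 0 := hP (by simpa using h)
    have e0 := congrArg (fun x => x 0) h0
    have e1 := congrArg (fun x => x 1) h0
    simp at e0 e1
    exact ⟨e0, e1⟩
  have ha0 : 0 < G a a := hpos a fun h => by simpa using key 1 0 (by simp [h])
  -- This is the Gram–Schmidt vector orthogonal to a, cleared of denominators; its squared length is
  -- G a a times the Gram determinant.
  have hw : 0 < G ((-G a b) • a + G a a • b) ((-G a b) • a + G a a • b) :=
    hpos _ fun h => ha0.ne' (key _ _ h).2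
  simp only [map_add, map_smul, add_apply, smul_apply, smul_eq_mul, hG b a] at hw
  have : 0 < G a a * gram (fun u v => G u v) a b := by unfold gram; linarith
  exact (mul_pos_iff_of_pos_left ha0).mp this

theorem dualVector_eq {V : Type*} [Zero V] {B : V → V → ℝ} {ℓ : V → ℝ} {w : V}
    (hB : ∀ w w', (∀ v, B w v = B w' v) → w = w') (hw : ∀ v, B w v = ℓ v) :
    dualVector B ℓ = w := by
  have h : ∃ w, ∀ v, B w v = ℓ v := ⟨w, hw⟩
  unfold dualVector
  rw [dif_pos h]
  exact hB _ _ fun v => (h.choose_spec v).trans (hw v).symm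

theorem dualVector_alternating (hα : ∀ v, α v v = 0) (hα0 : α (stdVec 0) (stdVec 1) ≠ 0)
    (ℓ : EuclideanSpace ℝ (Fin 2) →L[ℝ] ℝ) :
    dualVector (fun z v => α z v) (fun v => ℓ v)
      = (ℓ (stdVec 1) / α (stdVec 0) (stdVec 1)) • stdVec 0
        - (ℓ (stdVec 0) / α (stdVec 0) (stdVec 1)) • stdVec 1 := by
  refine dualVector_eq (fun w w' h => ?_) fun v => ?_
  · have h0 := h (stdVec 0)
    have h1 := h (stdVec 1)
    rw [alternating_apply hα, alternating_apply hα w'] at h0 h1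
    ext i
    fin_cases i <;> simp_all
  · rw [alternating_apply hα, eq_add_stdVec v]
    simp
    field_simp
    ring

/-- Cramer's rule for the Gram matrix. It serves both the gradient of λ and the tangential
projection. -/
theorem dualVector_symmetric (hB : ∀ u v, B u v = B v u)
    (hΔ : gram (fun u v => B u v) (stdVec 0) (stdVec 1) ≠ 0)
    (ℓ : EuclideanSpace ℝ (Fin 2) →L[ℝ] ℝ) :
    dualVector (fun z v => B z v) (fun v => ℓ v)
      = ((B (stdVec 1) (stdVec 1) * ℓ (stdVec 0) - B (stdVec 0) (stdVec 1) * ℓ (stdVec 1))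
            / gram (fun u v => B u v) (stdVec 0) (stdVec 1)) • stdVec 0
        + ((B (stdVec 0) (stdVec 0) * ℓ (stdVec 1) - B (stdVec 0) (stdVec 1) * ℓ (stdVec 0))
            / gram (fun u v => B u v) (stdVec 0) (stdVec 1)) • stdVec 1 := by
  refine dualVector_eq (fun w w' h => ?_) fun v => ?_
  · have h0 := h (stdVec 0)
    have h1 := h (stdVec 1)
    rw [eq_add_stdVec w, eq_add_stdVec w'] at h0 h1
    simp only [map_add, map_smul, add_apply, smul_apply, smul_eq_mul,
      hB (stdVec 1) (stdVec 0)] at h0 h1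
    unfold gram at hΔ
    have k0 : w 0 = w' 0 := mul_right_cancel₀ hΔ (by
      linear_combination B (stdVec 1) (stdVec 1) * h0 - B (stdVec 0) (stdVec 1) * h1)
    have k1 : w 1 = w' 1 := mul_right_cancel₀ hΔ (by
      linear_combination B (stdVec 0) (stdVec 0) * h1 - B (stdVec 0) (stdVec 1) * h0)
    ext i
    fin_cases i
    · exact k0
    · exact k1
  · rw [eq_add_stdVec v]
    simp only [map_add, map_smul, add_apply, smul_apply, smul_eq_mul, hB (stdVec 1) (stdVec 0)]
    field_simp
    unfold gram
    ring

end Planar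

/-! ### The differentials of the Kähler ratios and of the area ratio. -/

section Surface

variable
  {S : Type*} [TopologicalSpace S] [ChartedSpace (EuclideanSpace ℝ (Fin 2)) S]
  [IsManifold (𝓡 2) ∞ S]
  {M : Type*} [TopologicalSpace M] [ChartedSpace (EuclideanSpace ℝ (Fin 4)) M]
  [IsManifold (𝓡 4) ∞ M]

/-- The pullback of a bilinear form field at a point, on the model space. -/
def pullbackAt (b : BilinField 4 M) (f : S → M) (p : S) :
    EuclideanSpace ℝ (Fin 2) →L[ℝ] EuclideanSpace ℝ (Fin 2) →L[ℝ] ℝ :=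
  (formAt b (f p)).bilinearComp (pushAt 2 4 f p) (pushAt 2 4 f p)

theorem injective_ofCoord {p x : S}
    (hx : x ∈ (chartAt (EuclideanSpace ℝ (Fin 2)) p).source) :
    Function.Injective (ofCoord 2 S p x) :=
  Function.LeftInverse.injective (toCoord_ofCoord hx)

theorem VolumeForm.formAt_ne_zero (ρ : VolumeForm S) (p : S) :
    formAt ρ.form p (stdVec 0) (stdVec 1) ≠ 0 :=
  alternating_stdVec_ne_zero (ρ.alternating p) (ρ.ne_zero p)

theorem IsKahler.formAt_self {g : Metric 4 M} {J : EndField 4 M} (hJ : IsKahler g J) (q : M)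
    (v : EuclideanSpace ℝ (Fin 4)) : formAt (kahlerForm g J) q v v = 0 :=
  apply_self_eq_zero_of_orthogonal (G := metricAt g q) (J := endAt J q) (metricAt_symm g q)
    (hJ.sq q) (hJ.orthogonal q) v

/-- At x the ratio is defined with the frame of the chart at x. A quotient of alternating forms is
the same in every frame, so the frame of the fixed chart at p may be used, in which both forms have
differentiable coefficients. -/
theorem kahlerRatio_eventuallyEq (ρ : VolumeForm S) {g : Metric 4 M} {J : EndField 4 M}
    (hJ : IsKahler g J) {f : S → M} (hf : ContMDiff (𝓡 2) (𝓡 4) ∞ f) (p : S) :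
    kahlerRatio ρ g J f ∘ (chartAt (EuclideanSpace ℝ (Fin 2)) p).symm
      =ᶠ[𝓝 (chartAt (EuclideanSpace ℝ (Fin 2)) p p)]
        fun y => coordPullback (kahlerForm g J) f p (stdVec 0) (stdVec 1) y
          / coordForm ρ.form p y (stdVec 0) (stdVec 1) := by
  filter_upwards [pullback_ofCoord_eventuallyEq (kahlerForm g J) hf p (stdVec 0) (stdVec 1),
    (tendsto_chart_symm (n := 2) p).eventually (eventually_mem_chart_source (n := 2) p)]
    with y hy hx
  rw [← hy, coordForm_apply]
  exact alternating_ratio_comp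
    (α := pullbackAt (kahlerForm g J) f ((chartAt (EuclideanSpace ℝ (Fin 2)) p).symm y))
    (β := formAt ρ.form ((chartAt (EuclideanSpace ℝ (Fin 2)) p).symm y))
    (fun v => hJ.formAt_self _ _) (ρ.alternating _)
    (T := ofCoord 2 S p ((chartAt (EuclideanSpace ℝ (Fin 2)) p).symm y)) (injective_ofCoord hx)

/-- The square of the density `λ`, in the charts at `p` and `f p`. -/
def coordAreaSq (ρ : VolumeForm S) (g : Metric 4 M) (f : S → M) (p : S)
    (y : EuclideanSpace ℝ (Fin 2)) : ℝ :=
  gram (fun u v => coordPullback g.inner f p u v y) (stdVec 0) (stdVec 1)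
    / coordForm ρ.form p y (stdVec 0) (stdVec 1) ^ 2

/-- The same change of frame applies, since the Gram determinant and the square of the ρ-coefficient
are multiplied by the same squared determinant. The form √(Gram / r²) has no sign factor left to
differentiate. -/
theorem areaRatio_eventuallyEq (ρ : VolumeForm S) (g : Metric 4 M)
    {f : S → M} (hf : ContMDiff (𝓡 2) (𝓡 4) ∞ f) (p : S) :
    areaRatio ρ g f ∘ (chartAt (EuclideanSpace ℝ (Fin 2)) p).symm
      =ᶠ[𝓝 (chartAt (EuclideanSpace ℝ (Fin 2)) p p)] fun y => √(coordAreaSq ρ g f p y) := by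
  filter_upwards [pullback_ofCoord_eventuallyEq g.inner hf p (stdVec 0) (stdVec 0),
    pullback_ofCoord_eventuallyEq g.inner hf p (stdVec 0) (stdVec 1),
    pullback_ofCoord_eventuallyEq g.inner hf p (stdVec 1) (stdVec 1),
    (tendsto_chart_symm (n := 2) p).eventually (eventually_mem_chart_source (n := 2) p)]
    with y h00 h01 h11 hx
  rw [coordAreaSq, gram, ← h00, ← h01, ← h11, coordForm_apply]
  exact area_ratio_comp
    (B := pullbackAt g.inner f ((chartAt (EuclideanSpace ℝ (Fin 2)) p).symm y))
    (β := formAt ρ.form ((chartAt (EuclideanSpace ℝ (Fin 2)) p).symm y))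
    (fun u v => g.symm _ _ _) (ρ.alternating _) (ρ.ne_zero _)
    (T := ofCoord 2 S p ((chartAt (EuclideanSpace ℝ (Fin 2)) p).symm y)) (injective_ofCoord hx)

/-- The derivative of the coefficient of the volume form, in the chart at `p`. -/
def volumeDeriv (ρ : VolumeForm S) (p : S) (u : EuclideanSpace ℝ (Fin 2)) : ℝ :=
  fderiv ℝ (coordForm ρ.form p) (chartAt (EuclideanSpace ℝ (Fin 2)) p p) u (stdVec 0) (stdVec 1)

theorem fderiv_volume (ρ : VolumeForm S) (p : S) :
    DifferentiableAt ℝ (fun y => coordForm ρ.form p y (stdVec 0) (stdVec 1))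
      (chartAt (EuclideanSpace ℝ (Fin 2)) p p) ∧
    ∀ u, fderiv ℝ (fun y => coordForm ρ.form p y (stdVec 0) (stdVec 1))
      (chartAt (EuclideanSpace ℝ (Fin 2)) p p) u = volumeDeriv ρ p u := by
  have h := BilinField.IsSmooth.differentiableAt_coordForm ρ.smooth p
  exact ⟨(h.clm_apply (differentiableAt_const _)).clm_apply (differentiableAt_const _),
    fun u => fderiv_apply_apply h u _ _⟩

theorem fderiv_div_apply {E : Type*} [NormedAddCommGroup E] [NormedSpace ℝ E] {a b : E → ℝ}
    {x : E} (ha : DifferentiableAt ℝ a x) (hb : DifferentiableAt ℝ b x) (h0 : b x ≠ 0) :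
    DifferentiableAt ℝ (fun y => a y / b y) x ∧
    ∀ u, fderiv ℝ (fun y => a y / b y) x u
      = fderiv ℝ a x u / b x - a x * fderiv ℝ b x u / b x ^ 2 := by
  have h : HasFDerivAt (fun y => a y * (b y)⁻¹) _ x :=
    ha.hasFDerivAt.mul ((hasDerivAt_inv h0).comp_hasFDerivAt x hb.hasFDerivAt)
  simp only [← div_eq_mul_inv] at h
  refine ⟨h.differentiableAt, fun u => ?_⟩
  rw [h.fderiv]
  simp
  field_simp
  ring

/-- The derivative of `λ = √((A C - B²) / r²)`. -/
theorem fderiv_sqrt_gram_div {E : Type*} [NormedAddCommGroup E] [NormedSpace ℝ E]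
    {A B C r : E → ℝ} {x : E} (hA : DifferentiableAt ℝ A x) (hB : DifferentiableAt ℝ B x)
    (hC : DifferentiableAt ℝ C x) (hr : DifferentiableAt ℝ r x) (hr0 : r x ≠ 0)
    (hpos : 0 < A x * C x - B x ^ 2) :
    DifferentiableAt ℝ (fun y => √((A y * C y - B y ^ 2) / r y ^ 2)) x ∧
    ∀ u, √((A x * C x - B x ^ 2) / r x ^ 2)
        * fderiv ℝ (fun y => √((A y * C y - B y ^ 2) / r y ^ 2)) x u
      = (fderiv ℝ A x u * C x + A x * fderiv ℝ C x u - 2 * B x * fderiv ℝ B x u) / (2 * r x ^ 2)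
        - (A x * C x - B x ^ 2) * fderiv ℝ r x u / r x ^ 3 := by
  have hN : HasFDerivAt (fun y => A y * C y - B y ^ 2) _ x :=
    (hA.hasFDerivAt.mul hC.hasFDerivAt).sub (hB.hasFDerivAt.pow 2)
  have hD : HasFDerivAt (fun y => r y ^ 2) _ x := hr.hasFDerivAt.pow 2
  obtain ⟨hq, hq'⟩ := fderiv_div_apply hN.differentiableAt hD.differentiableAt
    (pow_ne_zero 2 hr0)
  have hQ : 0 < (A x * C x - B x ^ 2) / r x ^ 2 := by positivity
  have hs := hq.hasFDerivAt.sqrt hQ.ne'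
  refine ⟨hs.differentiableAt, fun u => ?_⟩
  -- The factor λ cancels the denominator 2λ from the derivative of the square root: λ dλ = ½ d(λ²),
  -- a rational expression.
  have h2 : √((A x * C x - B x ^ 2) / r x ^ 2) * (1 / (2 * √((A x * C x - B x ^ 2) / r x ^ 2)))
      = 1 / 2 := by
    have := (Real.sqrt_pos.mpr hQ).ne'
    field_simp
  rw [hs.fderiv, smul_apply, hq', hN.fderiv, hD.fderiv, smul_eq_mul, ← mul_assoc, h2]
  simp
  field_simp
  ring

/-- The coordinate expression of the differential of the Kähler ratio. -/
theorem differential_kahlerRatio (ρ : VolumeForm S) {g : Metric 4 M} {J : EndField 4 M}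
    (hJ : IsKahler g J) {f : S → M} (hf : ContMDiff (𝓡 2) (𝓡 4) ∞ f) (p : S) :
    ∃ L : EuclideanSpace ℝ (Fin 2) →L[ℝ] ℝ, (∀ u, differential (kahlerRatio ρ g J f) p u = L u) ∧
      ∀ u, L u = (formAt (kahlerForm g J) (f p) (covHessian g f p u (stdVec 0))
            (pushAt 2 4 f p (stdVec 1))
          + formAt (kahlerForm g J) (f p) (pushAt 2 4 f p (stdVec 0))
            (covHessian g f p u (stdVec 1))) / formAt ρ.form p (stdVec 0) (stdVec 1)
        - formAt (kahlerForm g J) (f p) (pushAt 2 4 f p (stdVec 0)) (pushAt 2 4 f p (stdVec 1))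
          * volumeDeriv ρ p u / formAt ρ.form p (stdVec 0) (stdVec 1) ^ 2 := by
  obtain ⟨hd, hd'⟩ := hJ.isParallelForm.fderiv_coordPullback (hf p) (stdVec 0) (stdVec 1)
  obtain ⟨hr, hr'⟩ := fderiv_volume ρ p
  have hr0 : coordForm ρ.form p (chartAt (EuclideanSpace ℝ (Fin 2)) p p) (stdVec 0) (stdVec 1)
      = formAt ρ.form p (stdVec 0) (stdVec 1) := coordForm_chart ρ.form p _ _
  obtain ⟨hq, hq'⟩ := fderiv_div_apply hd hr (hr0 ▸ ρ.formAt_ne_zero p)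
  refine ⟨_, mfderiv_apply_eq_fderiv_chart (kahlerRatio_eventuallyEq ρ hJ hf p) hq, fun u => ?_⟩
  rw [hq', hr0, hd', hr', coordPullback_chart _ (hf.mdifferentiable (by simp) p)]

theorem IsSmoothImmersion.gram_pos (g : Metric 4 M) {f : S → M} (hf : IsSmoothImmersion 2 4 f)
    (p : S) :
    0 < gram (fun u v => metricAt g (f p) u v) (pushAt 2 4 f p (stdVec 0))
      (pushAt 2 4 f p (stdVec 1)) :=
  gram_pos_of_injective (metricAt_symm g _) (metricAt_pos g _) (hf.injective p)

theorem areaRatio_eq (ρ : VolumeForm S) (g : Metric 4 M) {f : S → M}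
    (hf : ContMDiff (𝓡 2) (𝓡 4) ∞ f) (p : S) :
    areaRatio ρ g f p = √(gram (fun u v => metricAt g (f p) u v) (pushAt 2 4 f p (stdVec 0))
      (pushAt 2 4 f p (stdVec 1)) / formAt ρ.form p (stdVec 0) (stdVec 1) ^ 2) := by
  have h := (areaRatio_eventuallyEq ρ g hf p).self_of_nhds
  have hmd := hf.mdifferentiable (by simp) p
  rw [Function.comp_apply, OpenPartialHomeomorph.left_inv _ (mem_chart_source _ p)] at h
  refine h.trans ?_
  simp only [coordAreaSq, gram, coordPullback_chart _ hmd]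
  congr 3
  exact coordForm_chart ρ.form p _ _

/-- The coordinate expression of the differential of the area ratio. -/
theorem differential_areaRatio (ρ : VolumeForm S) (g : Metric 4 M)
    {f : S → M} (hf : IsSmoothImmersion 2 4 f) (p : S) :
    ∃ L : EuclideanSpace ℝ (Fin 2) →L[ℝ] ℝ, (∀ u, differential (areaRatio ρ g f) p u = L u) ∧
      ∀ u, areaRatio ρ g f p * L u =
        (let G := metricAt g (f p)
        let v := pushAt 2 4 f p (stdVec 0)
        let w := pushAt 2 4 f p (stdVec 1)
        let Dv := covHessian g f p u (stdVec 0)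
        let Dw := covHessian g f p u (stdVec 1)
        let r := formAt ρ.form p (stdVec 0) (stdVec 1)
        (2 * G Dv v * G w w + 2 * G v v * G Dw w - 2 * G v w * (G Dv w + G v Dw)) / (2 * r ^ 2)
          - gram (fun u v => G u v) v w * volumeDeriv ρ p u / r ^ 3) := by
  have hs := hf.smooth
  have hmd := hs.mdifferentiable (by simp) p
  have H := fun v w => (isParallelForm_metric g).fderiv_coordPullback (hs p) v w
  obtain ⟨hA, hA'⟩ := H (stdVec 0) (stdVec 0)
  obtain ⟨hB, hB'⟩ := H (stdVec 0) (stdVec 1)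
  obtain ⟨hC, hC'⟩ := H (stdVec 1) (stdVec 1)
  obtain ⟨hr, hr'⟩ := fderiv_volume ρ p
  have hr0 : coordForm ρ.form p (chartAt (EuclideanSpace ℝ (Fin 2)) p p) (stdVec 0) (stdVec 1)
      = formAt ρ.form p (stdVec 0) (stdVec 1) := coordForm_chart ρ.form p _ _
  have hpos := hf.gram_pos g p
  have hval (v w : EuclideanSpace ℝ (Fin 2)) := coordPullback_chart g.inner hmd v w
  obtain ⟨hq, hq'⟩ := fderiv_sqrt_gram_div hA hB hC hr (hr0 ▸ ρ.formAt_ne_zero p)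
    (by rw [hval, hval, hval]; exact hpos)
  refine ⟨_, mfderiv_apply_eq_fderiv_chart (areaRatio_eventuallyEq ρ g hs p) hq, fun u => ?_⟩
  have h := hq' u
  rw [hval, hval, hval, hA', hB', hC', hr', hr0] at h
  rw [areaRatio_eq ρ g hs]
  refine h.trans ?_
  have e : formAt g.inner (f p) = metricAt g (f p) := rfl
  simp only [e, gram, metricAt_symm g (f p) (pushAt 2 4 f p _) (covHessian g f p u _)]
  ring

end Surface

/-! ### Coordinate form of the two velocities and their equality. -/

section Velocity

variable
  {S : Type*} [TopologicalSpace S] [ChartedSpace (EuclideanSpace ℝ (Fin 2)) S]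
  [IsManifold (𝓡 2) ∞ S]
  {M : Type*} [TopologicalSpace M] [ChartedSpace (EuclideanSpace ℝ (Fin 4)) M]
  [IsManifold (𝓡 4) ∞ M]

theorem hamiltonianField_eq (ρ : VolumeForm S) {N : S → ℝ} {p : S}
    {L : EuclideanSpace ℝ (Fin 2) →L[ℝ] ℝ} (hL : ∀ u, differential N p u = L u) :
    hamiltonianField ρ N p
      = ((L (stdVec 1) / formAt ρ.form p (stdVec 0) (stdVec 1)) • stdVec 0
        - (L (stdVec 0) / formAt ρ.form p (stdVec 0) (stdVec 1)) • stdVec 1 :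
          EuclideanSpace ℝ (Fin 2)) := by
  rw [← dualVector_alternating (α := formAt ρ.form p) (ρ.alternating p) (ρ.formAt_ne_zero p)]
  exact congrArg (dualVector (fun z v => ρ.form p z v)) (funext hL)


theorem dualVector_inducedMetric (g : Metric 4 M) {f : S → M}
    (hf : IsSmoothImmersion 2 4 f) (p : S) (L : EuclideanSpace ℝ (Fin 2) →L[ℝ] ℝ) :
    dualVector (V := EuclideanSpace ℝ (Fin 2)) (fun z v => inducedMetric g f p z v) (fun v => L v)
      = (let G := metricAt g (f p)
        let v := pushAt 2 4 f p (stdVec 0)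
        let w := pushAt 2 4 f p (stdVec 1)
        ((G w w * L (stdVec 0) - G v w * L (stdVec 1)) / gram (fun a b => G a b) v w) • stdVec 0
        + ((G v v * L (stdVec 1) - G v w * L (stdVec 0)) / gram (fun a b => G a b) v w)
          • stdVec 1) :=
  dualVector_symmetric (B := pullbackAt g.inner f p) (fun u v => g.symm _ _ _)
    (hf.gram_pos g p).ne' L

/-- The normal part of a vector, in terms of the coordinate tangent vectors. -/
theorem normalPart_eq (g : Metric 4 M) {f : S → M}
    (hf : IsSmoothImmersion 2 4 f) (p : S) (D : EuclideanSpace ℝ (Fin 4)) :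
    normalPart (m := 2) g f p D
      = (let G := metricAt g (f p)
        let v := pushAt 2 4 f p (stdVec 0)
        let w := pushAt 2 4 f p (stdVec 1)
        D - (((G w w * G D v - G v w * G D w) / gram (fun u v => G u v) v w) • v
          + ((G v v * G D w - G v w * G D v) / gram (fun u v => G u v) v w) • w)) := by
  have h := dualVector_inducedMetric g hf p ((metricAt g (f p) D).comp (pushAt 2 4 f p))
  have h' := congrArg (fun z => D - pushAt 2 4 f p z) h
  refine h'.trans ?_
  simp only [map_add, map_smul, ContinuousLinearMap.comp_apply]

theorem meanCurvature_eq (g : Metric 4 M) {f : S → M} (hf : IsSmoothImmersion 2 4 f) (p : S) :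
    meanCurvature (m := 2) g f p
      = (let G := metricAt g (f p)
        let v := pushAt 2 4 f p (stdVec 0)
        let w := pushAt 2 4 f p (stdVec 1)
        let Δ := gram (fun a b => G a b) v w
        let nor (i j : Fin 2) : EuclideanSpace ℝ (Fin 4) :=
          normalPart (m := 2) g f p (covHessian g f p (stdVec i) (stdVec j))
        (G w w / Δ) • nor 0 0 + (-G v w / Δ) • nor 0 1
          + ((-G v w / Δ) • nor 1 0 + (G v v / Δ) • nor 1 1)) := by
  have hA (i j : Fin 2) : secondFundamentalForm g f p (coordVec p i) (coordVec p j)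
      = normalPart (m := 2) g f p (covHessian g f p (stdVec i) (stdVec j)) :=
    congrArg (normalPart (m := 2) g f p)
      (covDerivAlong_push_coordField g hf.smooth p (stdVec i) (stdVec j))
  have hM (i j : Fin 2) : inducedMetric g f p (coordVec p i) (coordVec p j)
      = metricAt g (f p) (pushAt 2 4 f p (stdVec i)) (pushAt 2 4 f p (stdVec j)) := rfl
  unfold meanCurvature
  simp only [hA, hM, Matrix.inv_def, Matrix.adjugate_fin_two, Matrix.det_fin_two,
    Fin.sum_univ_two, Matrix.of_apply, Matrix.smul_apply, Ring.inverse_eq_inv', gram,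
    Matrix.cons_val', Matrix.cons_val_zero, Matrix.cons_val_one, Matrix.cons_val_fin_one,
    smul_eq_mul, metricAt_symm g (f p) (pushAt 2 4 f p (stdVec 1)) (pushAt 2 4 f p (stdVec 0)),
    div_eq_inv_mul, ← pow_two]
  rfl

/-- All the data at p are transported to the fixed model spaces, where `hamiltonian_sum_eq` applies
with v, w the coordinate tangent vectors, Dᵢⱼ the covariant Hessian and mᵢ = λ ∂ᵢλ. -/
theorem hFlowVelocity_eq {f : S → M} (ρ : VolumeForm S) (h : HyperkahlerStructure M)
    (hf : IsSmoothImmersion 2 4 f) (p : S) :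
    hFlowVelocity ρ h f p = meanCurvatureVelocity ρ h.metric f p := by
  have hs := hf.smooth
  set g := h.metric with hg
  have hΔ := hf.gram_pos g p
  have hr := ρ.formAt_ne_zero p
  have hD := covHessian_symm g (hs p) (stdVec 1) (stdVec 0)
  obtain ⟨LI, hLI, hLI'⟩ := differential_kahlerRatio ρ h.kahler_I hs p
  obtain ⟨LJ, hLJ, hLJ'⟩ := differential_kahlerRatio ρ h.kahler_J hs p
  obtain ⟨LK, hLK, hLK'⟩ := differential_kahlerRatio ρ h.kahler_K hs p
  obtain ⟨Ll, hLl, hLl'⟩ := differential_areaRatio ρ g hf p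
  have hlam : areaRatio ρ g f p ^ 2 = gram (fun u v => metricAt g (f p) u v)
      (pushAt 2 4 f p (stdVec 0)) (pushAt 2 4 f p (stdVec 1))
        / formAt ρ.form p (stdVec 0) (stdVec 1) ^ 2 := by
    rw [areaRatio_eq ρ g hs, Real.sq_sqrt (by positivity)]
  set G := metricAt g (f p) with hG
  set v := pushAt 2 4 f p (stdVec 0) with hv
  set w := pushAt 2 4 f p (stdVec 1) with hw
  set r := formAt ρ.form p (stdVec 0) (stdVec 1) with hr_def
  -- One formula, with the endomorphism as a parameter, covers the derivatives of all three Kähler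
  -- ratios.
  let N (u : EuclideanSpace ℝ (Fin 2))
      (L : EuclideanSpace ℝ (Fin 4) →L[ℝ] EuclideanSpace ℝ (Fin 4)) : ℝ :=
    (G (L (covHessian g f p u (stdVec 0))) w + G (L v) (covHessian g f p u (stdVec 1))) / r
      - G (L v) w * volumeDeriv ρ p u / r ^ 2
  have hI (u) : LI u = N u (endAt h.I (f p)) := hLI' u
  have hJ (u) : LJ u = N u (endAt h.J (f p)) := hLJ' u
  have hK (u) : LK u = N u (endAt h.K (f p)) := hLK' u
  have key := hamiltonian_sum_eq (G := G) (I := endAt h.I (f p))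
    (J := endAt h.J (f p)) (K := endAt h.K (f p)) (by simp) (metricAt_symm g (f p))
    (metricAt_pos g (f p)) (h.kahler_I.sq _) (h.kahler_I.orthogonal _)
    (h.kahler_J.sq _) (h.kahler_J.orthogonal _) (h.kahler_K.sq _) (h.kahler_K.orthogonal _)
    (h.mul_eq _) v w
    (covHessian g f p (stdVec 0) (stdVec 0)) (covHessian g f p (stdVec 0) (stdVec 1))
    (covHessian g f p (stdVec 1) (stdVec 1)) r
    (volumeDeriv ρ p (stdVec 0)) (volumeDeriv ρ p (stdVec 1)) _ hr rfl hΔ.ne'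
    (N (stdVec 0)) (N (stdVec 1)) (fun _ => rfl) (fun _ => by simp only [N, hD]) _ _
    (areaRatio ρ g f p * Ll (stdVec 0)) (areaRatio ρ g f p * Ll (stdVec 1)) rfl rfl
    (hLl' (stdVec 0)) ((hLl' (stdVec 1)).trans (by rw [hD]; rfl))
    (normalPart (m := 2) g f p) (normalPart_eq g hf p)
  have hleft : hFlowVelocity ρ h f p
      = endAt h.I (f p) (pushAt 2 4 f p (hamiltonianField ρ (kahlerRatio ρ g h.I f) p))
        + endAt h.J (f p) (pushAt 2 4 f p (hamiltonianField ρ (kahlerRatio ρ g h.J f) p))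
        + endAt h.K (f p) (pushAt 2 4 f p (hamiltonianField ρ (kahlerRatio ρ g h.K f) p)) := rfl
  have hgrad : gradient (m := 2) g f (areaRatio ρ g f) p = _ :=
    (congrArg (dualVector (fun z v => inducedMetric g f p z v)) (funext hLl)).trans
      (dualVector_inducedMetric g hf p Ll)
  -- The mean curvature is named as an opaque vector of the model space, so that its coordinate
  -- formula can be substituted there.
  obtain ⟨H, hH⟩ : ∃ H : EuclideanSpace ℝ (Fin 4), H = meanCurvature (m := 2) g f p := ⟨_, rfl⟩
  have hH' := hH.trans (meanCurvature_eq g hf p)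
  have hright : meanCurvatureVelocity ρ g f p
      = areaRatio ρ g f p • pushAt 2 4 f p (gradient (m := 2) g f (areaRatio ρ g f) p)
        + areaRatio ρ g f p ^ 2 • H := by rw [hH]; rfl
  rw [hleft, hright, hlam, hamiltonianField_eq ρ hLI, hamiltonianField_eq ρ hLJ,
    hamiltonianField_eq ρ hLK, hgrad, hH']
  simp only [map_sub (pushAt 2 4 f p), map_add (pushAt 2 4 f p), map_smul (pushAt 2 4 f p),
    hI, hJ, hK, hD]
  refine key.trans ?_
  congr 1
  -- Only the gradient term remains, and there the outer factor λ has to be moved onto the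
  -- derivatives Lᵢ to form mᵢ.
  simp only [gram, ← hv, ← hw, ← hG]
  match_scalars <;> ring

end Velocity

end

end HFlow

theorem proposition2p1
    {S : Type*} [TopologicalSpace S] [ChartedSpace (EuclideanSpace ℝ (Fin 2)) S]
    [IsManifold (𝓡 2) ∞ S]
    {M : Type*} [TopologicalSpace M] [ChartedSpace (EuclideanSpace ℝ (Fin 4)) M]
    [IsManifold (𝓡 4) ∞ M]
    (ρ : HFlow.VolumeForm S) (h : HFlow.HyperkahlerStructure M) :
    (∀ f : S → M, HFlow.IsSmoothImmersion 2 4 f → ∀ p : S,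
      HFlow.hFlowVelocity ρ h f p = HFlow.meanCurvatureVelocity ρ h.metric f p) ∧
    (∀ (T : Set ℝ) (F : ℝ → S → M), (∀ t ∈ T, HFlow.IsSmoothImmersion 2 4 (F t)) →
      (HFlow.SolvesFlow (HFlow.hFlowVelocity ρ h) T F ↔
        HFlow.SolvesFlow (HFlow.meanCurvatureVelocity ρ h.metric) T F)) := by
  refine ⟨fun f hf p => HFlow.hFlowVelocity_eq ρ h hf p, fun T F hF => ?_⟩
  refine forall₂_congr fun t ht => forall_congr' fun p => ?_
  rw [HFlow.hFlowVelocity_eq ρ h (hF t ht) p]
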